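/- An operator mean $\sigma$ (in the sense of Kubo and Ando) assigns, on every complex Hilbert space $H$, to each pair of positive invertible operators $A,B\in\mathbb B(H)$ a positive invertible operator $A\sigma B\in\mathbb B(H)$ such that: (1) $I\sigma I=I$; (2) $C^*(A\sigma B)C\le (C^*AC)\sigma(C^*BC)$ for every $C\in\mathbb B(H)$ for which $C^*AC$ and $C^*BC$ are positive and invertible; (3) $A_n\downarrow A$ and $B_n\downarrow B$ imply $A_n\sigma B_n\downarrow A\sigma B$ (decreasing, with strong operator convergence); (4) $A\le B$ and $C\le D$ imply $A\sigma C\le B\sigma D$. Its representing function $f$ is given by $I\sigma(tI)=f(t)I$ for all $t>0$, on every Hilbert space. For a fixed orthonormal basis $(e_n)$ of $H$, let $U:H\to H\otimes H$ be the isometry with $Ue_n=e_n\otimes e_n$; the Hadamard product of $A,B\in\mathbb B(H)$ is $A\circ B=U^*(A\otimes B)U$. **Theorem.** Let $\sigma$ be an operator mean whose representing function $f$ is submultiplicative, i.e. $f(xy)\le f(x)f(y)$ for all $x,y>0$. Let $0<b_i<a_i$ for $i=1,\dots,4$, and put $$a=\frac{a_3a_4}{b_1b_2},\qquad b=\frac{b_3b_4}{a_1a_2},\qquad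 \mu=\frac{a_1a_2b_1b_2\,(f(a)-f(b))}{a_1a_2a_3a_4-b_1b_2b_3b_4}=\frac{f(a)-f(b)}{a-b},$$ $$\nu=\frac{a_1a_2a_3a_4f(b)-b_1b_2b_3b_4f(a)}{a_1a_2a_3a_4-b_1b_2b_3b_4}=\frac{af(b)-bf(a)}{a-b},\qquad g(t)=\mu t+\nu-f(t).$$ (i) If $f$ is not constant on $(0,\infty)$, there is a point $c\in(b,a)$, depending only on $f$ and the scalars $a_i,b_i$, such that $f$ is differentiable at $c$ with $f'(c)>0$, the number $$\omega=\frac{f(a)-f(b)}{(a-b)f'(c)}$$ is positive, and $$(A\circ B)\,\sigma\,(C\circ D)\le\frac1\omega\big((A\sigma C)\circ(B\sigma D)\big)$$ for every complex Hilbert space $H$, every orthonormal basis of $H$ and all $A,B,C,D\in\mathbb B(H)$ with $b_1I\le A\le a_1I$, $b_2I\le B\le a_2I$, $b_3I\le C\le a_3I$, $b_4I\le D\le a_4I$. (ii) There is a point $t_0\in(b,a)$, depending only on $f$ and the scalars $a_i,b_i$, such that $$(A\circ B)\,\sigma\,(C\circ D)-(A\sigma C)\circ(B\sigma D)\le -g(t_0)\,(A\circ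 B)$$ for all $H$, orthonormal bases and $A,B,C,D$ as in (i). -/

import Mathlib

open scoped TensorProduct InnerProductSpace
open Filter Topology

universe u v

noncomputable section

/-- The completed Hilbert space tensor product of `H` with itself. -/
abbrev HilbertTensor (H : Type u) [NormedAddCommGroup H] [InnerProductSpace ℂ H] : Type u :=
  UniformSpace.Completion (H ⊗[ℂ] H)

/-- The bounded operator `A ⊗ B` on the Hilbert space tensor product, characterised by
`(A ⊗ B) (x ⊗ y) = A x ⊗ B y`. -/
def tensorOp {H : Type u} [NormedAddCommGroup H] [InnerProductSpace ℂ H]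
    (A B : H →L[ℂ] H) : HilbertTensor H →L[ℂ] HilbertTensor H :=
  (TensorProduct.mapL A B).completion

section Hadamard

variable {H : Type u} [NormedAddCommGroup H] [InnerProductSpace ℂ H] {ι : Type v}

/-- For an orthonormal basis `e`, the vectors `eₙ ⊗ eₙ` are orthonormal. -/
theorem orthonormal_diag (e : HilbertBasis ι ℂ H) :
    Orthonormal ℂ (fun n => ((e n ⊗ₜ[ℂ] e n : H ⊗[ℂ] H) : HilbertTensor H)) := by
  classical
  have he := orthonormal_iff_ite.mp e.orthonormal
  rw [orthonormal_iff_ite]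
  intro i j
  rw [UniformSpace.Completion.inner_coe, TensorProduct.inner_tmul, he i j]
  split_ifs <;> simp

/-- The isometry `U : H → H ⊗ H` with `U eₙ = eₙ ⊗ eₙ`. -/
def diagIsometry (e : HilbertBasis ι ℂ H) : H →ₗᵢ[ℂ] HilbertTensor H :=
  (orthonormal_diag e).orthogonalFamily.linearIsometry.comp e.repr.toLinearIsometry

/-- The Hadamard product `A ∘ B = U* (A ⊗ B) U` with respect to the orthonormal basis `e`. -/
def hadamardProd [CompleteSpace H] (e : HilbertBasis ι ℂ H) (A B : H →L[ℂ] H) : H →L[ℂ] H :=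
  ContinuousLinearMap.adjoint (diagIsometry e).toContinuousLinearMap ∘L
    tensorOp A B ∘L (diagIsometry e).toContinuousLinearMap

end Hadamard

/-- `Aₙ ↓ L`: the sequence is decreasing in the Loewner order and converges to `L` in the
strong operator topology. -/
def DecreasesTo {H : Type u} [NormedAddCommGroup H] [InnerProductSpace ℂ H]
    (A : ℕ → H →L[ℂ] H) (L : H →L[ℂ] H) : Prop :=
  Antitone A ∧ ∀ x : H, Tendsto (fun n => A n x) atTop (𝓝 (L x))

/-- An operator mean in the sense of Kubo and Ando: on every complex Hilbert space, a binary
operation on the strictly positive (that is, positive and invertible) bounded operators,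
subject to normalisation, the transformer inequality, continuity from above and joint
monotonicity. The values of `op` outside the strictly positive operators are irrelevant. -/
structure OperatorMean where
  /-- `A σ B` -/
  op : ∀ {H : Type u} [NormedAddCommGroup H] [InnerProductSpace ℂ H] [CompleteSpace H],
    (H →L[ℂ] H) → (H →L[ℂ] H) → (H →L[ℂ] H)
  isStrictlyPositive_op : ∀ {H : Type u} [NormedAddCommGroup H] [InnerProductSpace ℂ H]
    [CompleteSpace H] (A B : H →L[ℂ] H),
    IsStrictlyPositive A → IsStrictlyPositive B → IsStrictlyPositive (op A B)
  op_one_one : ∀ {H : Type u} [NormedAddCommGroup H] [InnerProductSpace ℂ H] [CompleteSpace H],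
    op (1 : H →L[ℂ] H) 1 = 1
  transformer : ∀ {H : Type u} [NormedAddCommGroup H] [InnerProductSpace ℂ H] [CompleteSpace H]
    (A B C : H →L[ℂ] H), IsStrictlyPositive A → IsStrictlyPositive B →
    IsStrictlyPositive (star C * A * C) → IsStrictlyPositive (star C * B * C) →
    star C * op A B * C ≤ op (star C * A * C) (star C * B * C)
  continuous_above : ∀ {H : Type u} [NormedAddCommGroup H] [InnerProductSpace ℂ H]
    [CompleteSpace H] (A B : ℕ → H →L[ℂ] H) (A' B' : H →L[ℂ] H),
    (∀ n, IsStrictlyPositive (A n)) → (∀ n, IsStrictlyPositive (B n)) →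
    IsStrictlyPositive A' → IsStrictlyPositive B' →
    DecreasesTo A A' → DecreasesTo B B' → DecreasesTo (fun n => op (A n) (B n)) (op A' B')
  mono : ∀ {H : Type u} [NormedAddCommGroup H] [InnerProductSpace ℂ H] [CompleteSpace H]
    (A B C D : H →L[ℂ] H), IsStrictlyPositive A → IsStrictlyPositive B →
    IsStrictlyPositive C → IsStrictlyPositive D → A ≤ B → C ≤ D → op A C ≤ op B D

/-- `f` is the representing function of `σ`: `I σ (t I) = f(t) I` for all `t > 0`. -/
def OperatorMean.IsRepresentedBy (σ : OperatorMean.{u}) (f : ℝ → ℝ) : Prop :=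
  ∀ (H : Type u) [NormedAddCommGroup H] [InnerProductSpace ℂ H] [CompleteSpace H] (t : ℝ),
    0 < t → σ.op (1 : H →L[ℂ] H) (t • (1 : H →L[ℂ] H)) = f t • (1 : H →L[ℂ] H)

/-- `f` is submultiplicative on `(0, ∞)`. -/
def Submultiplicative (f : ℝ → ℝ) : Prop :=
  ∀ x y : ℝ, 0 < x → 0 < y → f (x * y) ≤ f x * f y

end

noncomputable section

/-! ### Joint functional calculus of two commuting self-adjoint elements. -/

section CommutingPairs

open Complex ComplexStarModule
open scoped ComplexOrder

variable {A : Type*} [CStarAlgebra A]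

/-! Both inequalities come from trapping `f` on `[b, a]` between the chord `μ t + ν` and an affine
majorant, then passing from scalars to operators.

The link is `A σ C = A^(1/2) f(A^(-1/2) C A^(-1/2)) A^(1/2)`, derived from the axioms in
`op_one_eq_cfc` and `exists_op_eq`. Lower half: `f` is concave, so with submultiplicativity `μ s t +
ν ≤ f (s t) ≤ f s * f t`. Applying this to the commuting operators `S ⊗ 1` and `1 ⊗ T`, conjugating
by `A^(1/2) ⊗ B^(1/2)` and compressing by `U` gives `μ (C ∘ D) + ν (A ∘ B) ≤ (A σ C) ∘ (B σ D)`.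
Upper half: `b (A ∘ B) ≤ C ∘ D ≤ a (A ∘ B)`, so `f t ≤ p t + q` on `[b, a]` gives `(A ∘ B) σ (C ∘ D)
≤ p (C ∘ D) + q (A ∘ B)`. Both halves are `hadamardProd_bounds`.

For (i) take `(p, q) = M (μ, ν)` with `M` the maximum of `f` over its chord; at an interior maximum
point `c`, `f'(c) = M μ`, so `M = 1/ω`. This needs `μ > 0`: a submultiplicative `f` with `f a ≤ f b`
is constant. For (ii) shift the chord up by the maximum of `f` minus chord. Concavity of `f` and
convexity of `x ↦ f (1/x)` are read off from `2 × 2` matrices; together they make `f`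
differentiable. -/

theorem IsSelfAdjoint.isStarNormal_add_I_smul {S T : A} (hS : IsSelfAdjoint S)
    (hT : IsSelfAdjoint T) (hST : Commute S T) : IsStarNormal (S + I • T) := by
  refine ⟨?_⟩
  have h1 : star (S + I • T) = S - I • T := by
    simp [hS.star_eq, hT.star_eq, sub_eq_add_neg]
  rw [h1, Commute, SemiconjBy]
  simp only [sub_mul, mul_add, add_mul, mul_sub, smul_mul_assoc, mul_smul_comm, hST.eq, smul_add, smul_sub]
  abel

theorem IsSelfAdjoint.realPart_add_I_smul {S T : A} (hS : IsSelfAdjoint S)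
    (hT : IsSelfAdjoint T) : (ℜ (S + I • T) : A) = S := by
  simp [hS.coe_realPart, hT.imaginaryPart]

theorem IsSelfAdjoint.imaginaryPart_add_I_smul {S T : A} (hS : IsSelfAdjoint S)
    (hT : IsSelfAdjoint T) : (ℑ (S + I • T) : A) = T := by
  simp [hT.coe_realPart, hS.imaginaryPart]

variable [PartialOrder A] [StarOrderedRing A]

/-- Both sides are continuous functions of the normal element `N = S + iT`. Real and imaginary parts
of its spectrum lie in the spectra of `S` and `T`, so the scalar inequality suffices. -/
theorem Commute.smul_mul_add_le_cfc_mul_cfc {S T : A} (hS : IsSelfAdjoint S)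
    (hT : IsSelfAdjoint T) (hST : Commute S T) {f : ℝ → ℝ}
    (hfS : ContinuousOn f (spectrum ℝ S)) (hfT : ContinuousOn f (spectrum ℝ T)) {μ ν : ℝ}
    (h : ∀ s ∈ spectrum ℝ S, ∀ t ∈ spectrum ℝ T, μ * (s * t) + ν ≤ f s * f t) :
    μ • (S * T) + ν • (1 : A) ≤ cfc f S * cfc f T := by
  have hN := hS.isStarNormal_add_I_smul hT hST
  have hre := hS.realPart_add_I_smul hT
  have him := hS.imaginaryPart_add_I_smul hT
  generalize S + I • T = N at hN hre him
  have hsre := spectrum_realPart' N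
  have hsim := spectrum_imaginaryPart' N
  rw [hre] at hsre
  rw [him] at hsim
  have c1 : ContinuousOn (fun x : ℂ => ((f x.re : ℝ) : ℂ)) (spectrum ℂ N) := by
    refine continuous_ofReal.comp_continuousOn (hfS.comp (by fun_prop) ?_)
    intro z hz
    exact hsre ▸ Set.mem_image_of_mem _ hz
  have c2 : ContinuousOn (fun x : ℂ => ((f x.im : ℝ) : ℂ)) (spectrum ℂ N) := by
    refine continuous_ofReal.comp_continuousOn (hfT.comp (by fun_prop) ?_)
    intro z hz
    exact hsim ▸ Set.mem_image_of_mem _ hz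
  have e1 : cfc f S = cfc (fun x : ℂ => (f x.re : ℂ)) N := by
    rw [cfc_comp_re f N (by rwa [hre]), hre]
  have e2 : cfc f T = cfc (fun x : ℂ => (f x.im : ℂ)) N := by
    rw [cfc_comp_im f N (by rwa [him]), him]
  have r1 : ContinuousOn (fun x : ℂ => (x.re : ℂ)) (spectrum ℂ N) := by fun_prop
  have r2 : ContinuousOn (fun x : ℂ => (x.im : ℂ)) (spectrum ℂ N) := by fun_prop
  have r3 : ContinuousOn (fun x : ℂ => (x.re : ℂ) * x.im) (spectrum ℂ N) := r1.mul r2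
  have r4 : ContinuousOn (fun x : ℂ => (μ : ℂ) * ((x.re : ℂ) * x.im)) (spectrum ℂ N) :=
    continuousOn_const.mul r3
  have e3 : S * T = cfc (fun x : ℂ => (x.re : ℂ) * x.im) N := by
    rw [cfc_mul _ _ _ r1 r2, cfc_re_id N, cfc_im_id N, hre, him]
  have e4 : μ • (S * T) + ν • (1 : A) =
      cfc (fun x : ℂ => (μ : ℂ) * ((x.re : ℂ) * x.im) + ν) N := by
    rw [cfc_add_const _ _ _ r4, cfc_const_mul _ _ _ r3, ← e3, Algebra.algebraMap_eq_smul_one]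
    simp
  rw [e4, e1, e2, ← cfc_mul _ _ _ c1 c2]
  refine (cfc_le_iff _ _ _ (r4.add continuousOn_const) (c1.mul c2)).2 ?_
  intro z hz
  have := h z.re (hsre ▸ Set.mem_image_of_mem _ hz) z.im (hsim ▸ Set.mem_image_of_mem _ hz)
  simp only [Pi.add_apply, Pi.mul_apply]
  exact_mod_cast this

/-- At a point `z` of the spectrum of `T + iM`, the bounds with parameter `t = re z` squeeze `im z`
between `g t t` and `k t t`, both equal to `f t`. Only bounds sharp at one point each are needed. -/
theorem Commute.eq_cfc_of_forall_le {T M : A} (hT : IsSelfAdjoint T) (hM : IsSelfAdjoint M)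
    (hTM : Commute T M) {f : ℝ → ℝ} (hf : ContinuousOn f (spectrum ℝ T))
    {g k : ℝ → ℝ → ℝ} (hg : ∀ t ∈ spectrum ℝ T, ContinuousOn (g t) (spectrum ℝ T))
    (hk : ∀ t ∈ spectrum ℝ T, ContinuousOn (k t) (spectrum ℝ T))
    (hgt : ∀ t ∈ spectrum ℝ T, g t t = f t) (hkt : ∀ t ∈ spectrum ℝ T, k t t = f t)
    (hgM : ∀ t ∈ spectrum ℝ T, cfc (g t) T ≤ M) (hkM : ∀ t ∈ spectrum ℝ T, M ≤ cfc (k t) T) :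
    M = cfc f T := by
  have hN := hT.isStarNormal_add_I_smul hM hTM
  have hre := hT.realPart_add_I_smul hM
  have him := hT.imaginaryPart_add_I_smul hM
  generalize T + I • M = N at hN hre him
  have hsre := spectrum_realPart' N
  rw [hre] at hsre
  have hmem : ∀ z ∈ spectrum ℂ N, z.re ∈ spectrum ℝ T := fun z hz =>
    hsre ▸ Set.mem_image_of_mem _ hz
  have c (φ : ℝ → ℝ) (hφ : ContinuousOn φ (spectrum ℝ T)) :
      ContinuousOn (fun x : ℂ => ((φ x.re : ℝ) : ℂ)) (spectrum ℂ N) :=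
    continuous_ofReal.comp_continuousOn (hφ.comp (by fun_prop) hmem)
  have e (φ : ℝ → ℝ) (hφ : ContinuousOn φ (spectrum ℝ T)) :
      cfc φ T = cfc (fun x : ℂ => (φ x.re : ℂ)) N := by
    rw [cfc_comp_re φ N (by rwa [hre]), hre]
  have r2 : ContinuousOn (fun x : ℂ => (x.im : ℂ)) (spectrum ℂ N) := by fun_prop
  have eM : M = cfc (fun x : ℂ => (x.im : ℂ)) N := by rw [cfc_im_id N, him]
  rw [e f hf]
  conv_lhs => rw [eM]
  refine cfc_congr fun z hz => ?_
  have h1 := hgM _ (hmem z hz)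
  have h2 := hkM _ (hmem z hz)
  rw [e _ (hg _ (hmem z hz)), eM, cfc_le_iff _ _ _ (c _ (hg _ (hmem z hz))) r2] at h1
  rw [e _ (hk _ (hmem z hz)), eM, cfc_le_iff _ _ _ r2 (c _ (hk _ (hmem z hz)))] at h2
  have h1 := h1 z hz
  have h2 := h2 z hz
  rw [hgt _ (hmem z hz)] at h1
  rw [hkt _ (hmem z hz)] at h2
  exact le_antisymm h2 h1

end CommutingPairs

section CommuteUnitary
open Complex

variable {A : Type*} [CStarAlgebra A] [PartialOrder A] [StarOrderedRing A]

/-- Conjugation by the unitaries commuting with `T` detects the elements of the bicommutant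
of `T`. -/
theorem commute_of_forall_unitary {T M : A} (hT : IsSelfAdjoint T)
    (h : ∀ u ∈ unitary A, Commute u T → star u * M * u = M) : Commute T M := by
  rcases subsingleton_or_nontrivial A with hA | hA
  · exact Subsingleton.elim _ _
  -- Once `a = r T` is a contraction, `u = a + i √(1 - a²)` is a unitary commuting with `T`, and `T`
  -- is a real multiple of `u + u*`.
  obtain ⟨r, hr, hr1⟩ : ∃ r : ℝ, 0 < r ∧ ‖r • T‖ ≤ 1 := by
    refine ⟨(‖T‖ + 1)⁻¹, by positivity, ?_⟩
    rw [norm_smul, norm_inv, Real.norm_of_nonneg (by positivity)]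
    rw [inv_mul_le_one₀ (by positivity)]
    linarith
  let a : selfAdjoint A := ⟨r • T, (IsSelfAdjoint.all r).smul hT⟩
  obtain ⟨u, hu, hsu, huv⟩ : ∃ u ∈ unitary A, star u = (a : A) - I • CFC.sqrt (1 - (a : A) ^ 2) ∧
      u = a + I • CFC.sqrt (1 - (a : A) ^ 2) :=
    ⟨_, (selfAdjoint.unitarySelfAddISMul a hr1).2, selfAdjoint.star_coe_unitarySelfAddISMul a hr1,
      rfl⟩
  have hcT : Commute (a : A) T := by
    change Commute (r • T) T
    exact (Commute.refl T).smul_left r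
  have hcs : Commute (CFC.sqrt (1 - (a : A) ^ 2)) T := by
    rw [CFC.sqrt_eq_cfc]
    exact (Commute.cfc_nnreal (((Commute.one_right T).sub_right (hcT.symm.pow_right 2)).symm) _)
  have hc : Commute u T := by
    rw [huv]
    exact hcT.add_left (hcs.smul_left I)
  have hM := h u hu hc
  have hMu : Commute u M := by
    have : u * (star u * M * u) = u * M := by rw [hM]
    rw [← mul_assoc, ← mul_assoc, Unitary.mul_star_self_of_mem hu, one_mul] at this
    exact this.symm
  have hM' := h (star u) (Unitary.star_mem hu) (by simpa [hT.star_eq] using hc.star_star)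
  have hMu' : Commute (star u) M := by
    have : star u * (star (star u) * M * star u) = star u * M := by rw [hM']
    rw [← mul_assoc, ← mul_assoc, star_star, Unitary.star_mul_self_of_mem hu, one_mul] at this
    exact this.symm
  have h2 : T = (r⁻¹ / 2) • (u + star u) := by
    rw [hsu, huv]
    have : (a : A) = r • T := rfl
    rw [add_add_sub_cancel, this, ← two_smul ℝ (r • T), smul_smul, smul_smul]
    field_simp
    simp
  rw [h2]
  exact (hMu.add_left hMu').smul_left _

end CommuteUnitary

/-! ### Real symmetric `2 × 2` matrices as test operators. -/

section TwoByTwo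

/-- A two-dimensional Hilbert space in an arbitrary universe. -/
abbrev TwoDim : Type u := EuclideanSpace ℂ (ULift.{u} (Fin 2))

/-- The operator on the two-dimensional Hilbert space with real matrix `M`. -/
def realMatrixOp (M : Matrix (Fin 2) (Fin 2) ℝ) : TwoDim.{u} →L[ℂ] TwoDim.{u} :=
  Matrix.toEuclideanCLM (𝕜 := ℂ) (n := ULift.{u} (Fin 2))
    (Matrix.of fun i j => (M i.down j.down : ℂ))

theorem realMatrixOp_one : realMatrixOp.{u} 1 = 1 := by
  rw [realMatrixOp, ← map_one (Matrix.toEuclideanCLM (𝕜 := ℂ) (n := ULift.{u} (Fin 2)))]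
  congr 1
  ext ⟨i⟩ ⟨j⟩
  by_cases h : i = j <;> simp [Matrix.one_apply, h]

theorem realMatrixOp_mul (M N : Matrix (Fin 2) (Fin 2) ℝ) :
    realMatrixOp.{u} (M * N) = realMatrixOp M * realMatrixOp N := by
  rw [realMatrixOp, realMatrixOp, realMatrixOp, ← map_mul]
  congr 1
  ext ⟨i⟩ ⟨j⟩
  simp only [Matrix.mul_apply, Matrix.of_apply]
  rw [← Equiv.ulift.symm.sum_comp]
  push_cast
  rfl

theorem realMatrixOp_add (M N : Matrix (Fin 2) (Fin 2) ℝ) :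
    realMatrixOp.{u} (M + N) = realMatrixOp M + realMatrixOp N := by
  rw [realMatrixOp, realMatrixOp, realMatrixOp, ← map_add]
  congr 1
  ext ⟨i⟩ ⟨j⟩
  simp

theorem realMatrixOp_smul (c : ℝ) (M : Matrix (Fin 2) (Fin 2) ℝ) :
    realMatrixOp.{u} (c • M) = c • realMatrixOp M := by
  have : c • realMatrixOp.{u} M = (c : ℂ) • realMatrixOp M := by
    ext x i; simp
  rw [this, realMatrixOp, realMatrixOp, ← map_smul]
  congr 1
  ext ⟨i⟩ ⟨j⟩
  simp

theorem realMatrixOp_star (M : Matrix (Fin 2) (Fin 2) ℝ) :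
    star (realMatrixOp.{u} M) = realMatrixOp (Matrix.transpose M) := by
  rw [realMatrixOp, realMatrixOp, ← map_star]
  congr 1
  ext ⟨i⟩ ⟨j⟩
  simp [Matrix.star_apply]

theorem realMatrixOp_nonneg {x y z : ℝ} (hx : 0 < x) (h : y ^ 2 ≤ x * z) :
    0 ≤ realMatrixOp.{u} !![x, y; y, z] := by
  have hz : 0 ≤ z - y ^ 2 / x := by
    rw [sub_nonneg, div_le_iff₀ hx]; linarith
  -- Cholesky factorisation; the last pivot is the Schur complement `z - y² / x`.
  have key : realMatrixOp.{u} !![x, y; y, z] =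
      star (realMatrixOp !![√x, y / √x; 0, √(z - y ^ 2 / x)]) *
        realMatrixOp !![√x, y / √x; 0, √(z - y ^ 2 / x)] := by
    rw [realMatrixOp_star, ← realMatrixOp_mul]
    congr 1
    have h1 : √x ≠ 0 := (Real.sqrt_pos.2 hx).ne'
    have h2 : √x ^ 2 = x := Real.sq_sqrt hx.le
    have h3 := Real.mul_self_sqrt hz
    ext i j
    fin_cases i <;> fin_cases j <;>
      simp [Matrix.mul_apply, Fin.sum_univ_two, Matrix.transpose_apply, h3]
    · rw [← sq, h2]
    · field_simp
    · field_simp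
    · rw [div_mul_div_comm, ← sq, ← sq, h2]; ring
  rw [key]
  exact star_mul_self_nonneg _

theorem realMatrixOp_le {x y z x' y' z' : ℝ} (hx : x < x')
    (h : (y' - y) ^ 2 ≤ (x' - x) * (z' - z)) :
    realMatrixOp.{u} !![x, y; y, z] ≤ realMatrixOp !![x', y'; y', z'] := by
  have : realMatrixOp.{u} !![x', y'; y', z'] = realMatrixOp !![x, y; y, z] +
      realMatrixOp !![x' - x, y' - y; y' - y, z' - z] := by
    rw [← realMatrixOp_add]
    congr 1
    ext i j
    fin_cases i <;> fin_cases j <;> simp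
  rw [this]
  exact le_add_of_nonneg_right (realMatrixOp_nonneg (sub_pos.2 hx) h)

theorem realMatrixOp_isStrictlyPositive {x y z : ℝ} (hx : 0 < x) (h : y ^ 2 < x * z) :
    IsStrictlyPositive (realMatrixOp.{u} !![x, y; y, z]) := by
  refine ⟨realMatrixOp_nonneg hx h.le, ?_⟩
  have hu : IsUnit (!![x, y; y, z] : Matrix (Fin 2) (Fin 2) ℝ) := by
    rw [Matrix.isUnit_iff_isUnit_det, Matrix.det_fin_two_of, isUnit_iff_ne_zero]
    nlinarith
  obtain ⟨w, hw⟩ := hu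
  have h1 := congrArg realMatrixOp.{u} w.mul_inv
  have h2 := congrArg realMatrixOp.{u} w.inv_mul
  rw [realMatrixOp_mul, realMatrixOp_one, hw] at h1 h2
  exact ⟨⟨_, _, h1, h2⟩, rfl⟩

theorem realMatrixOp_apply_zero_le {M N : Matrix (Fin 2) (Fin 2) ℝ}
    (h : realMatrixOp.{u} M ≤ realMatrixOp N) : M 0 0 ≤ N 0 0 := by
  have key (M : Matrix (Fin 2) (Fin 2) ℝ) : Complex.re (inner ℂ
      (realMatrixOp.{u} M (EuclideanSpace.single ⟨0⟩ 1)) (EuclideanSpace.single ⟨0⟩ 1)) =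
      M 0 0 := by
    simp [realMatrixOp, EuclideanSpace.inner_single_right]
  have := ((ContinuousLinearMap.le_def _ _).1 h).inner_nonneg_left
    (EuclideanSpace.single ⟨0⟩ 1)
  rw [_root_.sub_apply, inner_sub_left] at this
  have := (Complex.le_def.1 this).1
  rw [Complex.sub_re, key, key] at this
  simpa using this

end TwoByTwo

theorem smul_one_le_smul_one_iff {s t : ℝ} :
    s • (1 : TwoDim.{u} →L[ℂ] TwoDim.{u}) ≤ t • 1 ↔ s ≤ t := by
  refine ⟨fun h => ?_, fun h => ?_⟩
  swap
  · have := smul_nonneg (sub_nonneg.2 h) (zero_le_one (α := TwoDim.{u} →L[ℂ] TwoDim.{u}))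
    rwa [sub_smul, sub_nonneg] at this
  rw [← realMatrixOp_one, ← realMatrixOp_smul, ← realMatrixOp_smul] at h
  simpa using realMatrixOp_apply_zero_le h

/-! ### From the axioms to `1 σ T = f(T)`. -/

namespace OperatorMean

section

variable {H : Type u} [NormedAddCommGroup H] [InnerProductSpace ℂ H] [CompleteSpace H]
  (σ : OperatorMean.{u}) {f : ℝ → ℝ}

/-- The transformer inequality for `C⁻¹` is the reverse of the one for `C`. -/
theorem star_mul_op_mul {A B C : H →L[ℂ] H} (hA : IsStrictlyPositive A)
    (hB : IsStrictlyPositive B) (hC : IsUnit C) :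
    star C * σ.op A B * C = σ.op (star C * A * C) (star C * B * C) := by
  have hA' := hC.isStrictlyPositive_star_left_conjugate_iff.2 hA
  have hB' := hC.isStrictlyPositive_star_left_conjugate_iff.2 hB
  refine le_antisymm (σ.transformer A B C hA hB hA' hB') ?_
  obtain ⟨w, rfl⟩ := hC
  have e (X : H →L[ℂ] H) : star (↑w⁻¹ : H →L[ℂ] H) * (star (w : H →L[ℂ] H) * X * w) * ↑w⁻¹ = X := by
    have h1 : star (↑w⁻¹ : H →L[ℂ] H) * star (w : H →L[ℂ] H) = 1 := by
      rw [← star_mul, w.mul_inv, star_one]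
    rw [mul_assoc, mul_assoc _ (w : H →L[ℂ] H), w.mul_inv, mul_one, ← mul_assoc, h1, one_mul]
  have e' (X : H →L[ℂ] H) : star (w : H →L[ℂ] H) * (star (↑w⁻¹ : H →L[ℂ] H) * X * ↑w⁻¹) * w = X := by
    have h1 : star (w : H →L[ℂ] H) * star (↑w⁻¹ : H →L[ℂ] H) = 1 := by
      rw [← star_mul, w.inv_mul, star_one]
    rw [mul_assoc, mul_assoc _ (↑w⁻¹ : H →L[ℂ] H), w.inv_mul, mul_one, ← mul_assoc, h1, one_mul]
  have h := σ.transformer _ _ (↑w⁻¹ : H →L[ℂ] H) hA' hB' (by rwa [e]) (by rwa [e])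
  rw [e, e] at h
  have := star_left_conjugate_le_conjugate h (w : H →L[ℂ] H)
  rwa [e'] at this

theorem op_one_commute {T : H →L[ℂ] H} (hT : IsStrictlyPositive T) :
    Commute T (σ.op 1 T) := by
  refine commute_of_forall_unitary hT.isSelfAdjoint fun u hu huT => ?_
  rw [σ.star_mul_op_mul isStrictlyPositive_one hT (C := u) (Unitary.toUnits ⟨u, hu⟩).isUnit, mul_one,
    Unitary.star_mul_self_of_mem hu, mul_assoc, ← huT.eq, ← mul_assoc,
    Unitary.star_mul_self_of_mem hu, one_mul]

end

namespace IsRepresentedBy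

variable {H : Type u} [NormedAddCommGroup H] [InnerProductSpace ℂ H] [CompleteSpace H]
  {σ : OperatorMean.{u}} {f : ℝ → ℝ}

theorem op_smul_self (hf : σ.IsRepresentedBy f) {Y : H →L[ℂ] H} (hY : IsStrictlyPositive Y)
    {t : ℝ} (ht : 0 < t) : σ.op Y (t • Y) = f t • Y := by
  have hu := hY.isUnit_cfcSqrt
  have hs : star (CFC.sqrt Y) = CFC.sqrt Y := (CFC.sqrt_nonneg Y).isSelfAdjoint.star_eq
  have h := σ.star_mul_op_mul (isStrictlyPositive_one (A := H →L[ℂ] H))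
    (isStrictlyPositive_one.smul ht) hu
  rw [hs, hf H t ht] at h
  simpa [CFC.sqrt_mul_sqrt_self Y hY.nonneg] using h.symm

/-- Monotonicity compares `(1, T)` with the proportional pair `(Y, t Y)`, whose mean is known. This
and `le_op_one` supply all later bounds on `1 σ T`. -/
theorem op_one_le (hf : σ.IsRepresentedBy f) {T Y : H →L[ℂ] H} (hT : IsStrictlyPositive T)
    {t : ℝ} (ht : 0 < t) (h1 : 1 ≤ Y) (h2 : T ≤ t • Y) : σ.op 1 T ≤ f t • Y := by
  have hY := isStrictlyPositive_one.of_le h1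
  rw [← hf.op_smul_self hY ht]
  exact σ.mono _ _ _ _ isStrictlyPositive_one hY hT (hY.smul ht) h1 h2

theorem le_op_one (hf : σ.IsRepresentedBy f) {T Y : H →L[ℂ] H} (hT : IsStrictlyPositive T)
    (hY : IsStrictlyPositive Y)
    {t : ℝ} (ht : 0 < t) (h1 : Y ≤ 1) (h2 : t • Y ≤ T) : f t • Y ≤ σ.op 1 T := by
  rw [← hf.op_smul_self hY ht]
  exact σ.mono _ _ _ _ hY isStrictlyPositive_one (hY.smul ht) hT h1 h2

theorem map_one (hf : σ.IsRepresentedBy f) : f 1 = 1 := by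
  have h := hf TwoDim.{u} 1 one_pos
  rw [one_smul, σ.op_one_one] at h
  nth_rw 1 [← one_smul ℝ (1 : TwoDim.{u} →L[ℂ] TwoDim.{u})] at h
  exact le_antisymm (smul_one_le_smul_one_iff.1 h.ge) (smul_one_le_smul_one_iff.1 h.le)

theorem monotoneOn (hf : σ.IsRepresentedBy f) : MonotoneOn f (Set.Ioi 0) := by
  intro s hs t ht hst
  have h := hf.op_one_le (T := s • (1 : TwoDim.{u} →L[ℂ] TwoDim.{u}))
    (isStrictlyPositive_one.smul hs) ht le_rfl (smul_one_le_smul_one_iff.2 hst)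
  rw [hf _ s hs] at h
  exact smul_one_le_smul_one_iff.1 h

theorem le_div_mul (hf : σ.IsRepresentedBy f) {s t : ℝ} (hs : 0 < s) (hst : s ≤ t) :
    f t ≤ t / s * f s := by
  have ht := hs.trans_le hst
  have h := hf.op_one_le (T := t • (1 : TwoDim.{u} →L[ℂ] TwoDim.{u}))
    (Y := (t / s) • 1) (isStrictlyPositive_one.smul ht) hs ?_ ?_
  · rw [hf _ t ht, smul_smul, smul_one_le_smul_one_iff] at h
    linarith
  · nth_rw 1 [← one_smul ℝ (1 : TwoDim.{u} →L[ℂ] TwoDim.{u})]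
    rw [smul_one_le_smul_one_iff]
    exact (one_le_div hs).2 hst
  · rw [smul_smul, smul_one_le_smul_one_iff]
    exact (mul_div_cancel₀ t hs.ne').ge

theorem pos (hf : σ.IsRepresentedBy f) {t : ℝ} (ht : 0 < t) : 0 < f t := by
  rcases le_total t 1 with h | h
  · have := hf.le_div_mul ht h
    rw [hf.map_one] at this
    by_contra! h'
    have := mul_nonpos_of_nonneg_of_nonpos (one_div_pos.2 ht).le h'
    linarith
  · have := hf.monotoneOn (Set.mem_Ioi.2 one_pos) ht h
    rw [hf.map_one] at this
    linarith

/-- Since `f` is nondecreasing and `f t / t` nonincreasing, `f s` lies between `f t` and `(s / t) f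
t`. -/
theorem continuousOn (hf : σ.IsRepresentedBy f) : ContinuousOn f (Set.Ioi 0) := by
  intro t ht
  have ht : 0 < t := ht
  refine ContinuousAt.continuousWithinAt ?_
  have hl : Tendsto (fun s => min (f t) (s / t * f t)) (𝓝 t) (𝓝 (f t)) := by
    have : ContinuousAt (fun s => min (f t) (s / t * f t)) t := by fun_prop
    simpa [ContinuousAt, div_self ht.ne'] using this
  have hu : Tendsto (fun s => max (f t) (s / t * f t)) (𝓝 t) (𝓝 (f t)) := by
    have : ContinuousAt (fun s => max (f t) (s / t * f t)) t := by fun_prop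
    simpa [ContinuousAt, div_self ht.ne'] using this
  refine tendsto_of_tendsto_of_tendsto_of_le_of_le' hl hu ?_ ?_
  · filter_upwards [Ioi_mem_nhds ht] with s hs
    rcases le_total s t with h | h
    · refine (min_le_right _ _).trans ?_
      have := hf.le_div_mul hs h
      rw [div_mul_eq_mul_div, le_div_iff₀ hs] at this
      rw [div_mul_eq_mul_div, div_le_iff₀ ht]
      linarith
    · exact (min_le_left _ _).trans (hf.monotoneOn ht hs h)
  · filter_upwards [Ioi_mem_nhds ht] with s hs
    rcases le_total s t with h | h
    · exact (hf.monotoneOn hs ht h).trans (le_max_left _ _)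
    · exact (hf.le_div_mul ht h).trans (le_max_right _ _)

theorem continuousOn_spectrum (hf : σ.IsRepresentedBy f) {T : H →L[ℂ] H}
    (hT : IsStrictlyPositive T) : ContinuousOn f (spectrum ℝ T) :=
  hf.continuousOn.mono fun _ hx => hT.spectrum_pos hx

/-- For each `t` in the spectrum, `Y = max(1, T/t)` satisfies `1 ≤ Y` and `T ≤ t Y`, so `1 σ T ≤
f(t) Y`; `min(1, T/t)` gives the lower bound. Both are sharp at `t`, and `1 σ T` commutes with `T`.
-/
theorem op_one_eq_cfc (hf : σ.IsRepresentedBy f) {T : H →L[ℂ] H} (hT : IsStrictlyPositive T) :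
    σ.op 1 T = cfc f T := by
  have hTs := hT.isSelfAdjoint
  have hpos : ∀ t ∈ spectrum ℝ T, 0 < t := fun t ht => hT.spectrum_pos ht
  refine Commute.eq_cfc_of_forall_le (g := fun t x => f t * min 1 (x / t))
    (k := fun t x => f t * max 1 (x / t)) hTs
    (σ.isStrictlyPositive_op _ _ isStrictlyPositive_one hT).isSelfAdjoint
    (σ.op_one_commute hT) (hf.continuousOn_spectrum hT) (fun t _ => by fun_prop)
    (fun t _ => by fun_prop) (fun t ht => by simp [(hpos t ht).ne'])
    (fun t ht => by simp [(hpos t ht).ne']) (fun t ht => ?_) (fun t ht => ?_)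
  · rw [cfc_const_mul _ _ _]
    refine hf.le_op_one hT ?_ (hpos t ht) ?_ ?_
    · refine ⟨cfc_nonneg fun x hx => ?_, ?_⟩
      · have := hpos t ht; have := hpos x hx; positivity
      · refine (isUnit_cfc_iff _ _ (by fun_prop) hTs).2 fun x hx => ?_
        have := hpos t ht; have := hpos x hx; positivity
    · exact cfc_le_one _ _ fun x _ => min_le_left _ _
    · rw [← cfc_const_mul _ _ _ (by fun_prop)]
      nth_rw 2 [← cfc_id' ℝ T]
      refine cfc_mono (fun x hx => ?_) (by fun_prop) (by fun_prop)
      have := hpos t ht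
      calc t * min 1 (x / t) ≤ t * (x / t) := by gcongr; exact min_le_right _ _
        _ = x := by field_simp
  · rw [cfc_const_mul _ _ _]
    refine hf.op_one_le hT (hpos t ht) ?_ ?_
    · rw [← cfc_one ℝ T]
      exact cfc_mono (fun x _ => le_max_left _ _) (by fun_prop) (by fun_prop)
    · rw [← cfc_const_mul _ _ _ (by fun_prop)]
      nth_rw 1 [← cfc_id' ℝ T]
      refine cfc_mono (fun x hx => ?_) (by fun_prop) (by fun_prop)
      have := hpos t ht
      calc x = t * (x / t) := by field_simp
        _ ≤ t * max 1 (x / t) := by gcongr; exact le_max_right _ _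

end IsRepresentedBy

end OperatorMean

/-! ### Tensor products of operators, commuting representations and compressions. -/

section TensorOp

variable {H : Type u} [NormedAddCommGroup H] [InnerProductSpace ℂ H]

theorem HilbertTensor.ext_clm {F G : HilbertTensor H →L[ℂ] HilbertTensor H}
    (h : ∀ x y : H, F ((x ⊗ₜ[ℂ] y : H ⊗[ℂ] H) : HilbertTensor H) =
      G ((x ⊗ₜ[ℂ] y : H ⊗[ℂ] H) : HilbertTensor H)) : F = G := by
  ext z
  induction z using UniformSpace.Completion.induction_on with
  | hp => exact isClosed_eq F.continuous G.continuous
  | ih a =>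
    induction a using TensorProduct.induction_on with
    | zero => rw [UniformSpace.Completion.coe_zero, map_zero, map_zero]
    | tmul x y => exact h x y
    | add x y hx hy => rw [UniformSpace.Completion.coe_add, map_add, map_add, hx, hy]

theorem tensorOp_apply_tmul (A B : H →L[ℂ] H) (x y : H) :
    tensorOp A B ((x ⊗ₜ[ℂ] y : H ⊗[ℂ] H) : HilbertTensor H) =
      ((A x ⊗ₜ[ℂ] B y : H ⊗[ℂ] H) : HilbertTensor H) := by
  rw [tensorOp, ContinuousLinearMap.completion_apply_coe]
  rfl

theorem tensorOp_mul_tensorOp (A B C D : H →L[ℂ] H) :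
    tensorOp A B * tensorOp C D = tensorOp (A * C) (B * D) := by
  refine HilbertTensor.ext_clm fun x y => ?_
  change tensorOp A B (tensorOp C D _) = _
  rw [tensorOp_apply_tmul, tensorOp_apply_tmul, tensorOp_apply_tmul]
  rfl

theorem tensorOp_one_one : tensorOp (1 : H →L[ℂ] H) 1 = 1 := by
  refine HilbertTensor.ext_clm fun x y => ?_
  rw [tensorOp_apply_tmul]
  rfl

theorem tensorOp_add_left (A B C : H →L[ℂ] H) :
    tensorOp (A + B) C = tensorOp A C + tensorOp B C := by
  refine HilbertTensor.ext_clm fun x y => ?_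
  simp [tensorOp_apply_tmul, TensorProduct.add_tmul, UniformSpace.Completion.coe_add]

theorem tensorOp_add_right (A B C : H →L[ℂ] H) :
    tensorOp A (B + C) = tensorOp A B + tensorOp A C := by
  refine HilbertTensor.ext_clm fun x y => ?_
  simp [tensorOp_apply_tmul, TensorProduct.tmul_add, UniformSpace.Completion.coe_add]

theorem tensorOp_smul_left (c : ℂ) (A B : H →L[ℂ] H) :
    tensorOp (c • A) B = c • tensorOp A B := by
  refine HilbertTensor.ext_clm fun x y => ?_
  change tensorOp (c • A) B _ = c • tensorOp A B _
  rw [tensorOp_apply_tmul, tensorOp_apply_tmul, ← UniformSpace.Completion.coe_smul,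
    TensorProduct.smul_tmul']
  rfl

theorem tensorOp_smul_right (c : ℂ) (A B : H →L[ℂ] H) :
    tensorOp A (c • B) = c • tensorOp A B := by
  refine HilbertTensor.ext_clm fun x y => ?_
  change tensorOp A (c • B) _ = c • tensorOp A B _
  rw [tensorOp_apply_tmul, tensorOp_apply_tmul, ← UniformSpace.Completion.coe_smul,
    ← TensorProduct.tmul_smul]
  rfl

variable [CompleteSpace H]

theorem star_tensorOp (A B : H →L[ℂ] H) :
    star (tensorOp A B) = tensorOp (star A) (star B) := by
  symm
  rw [ContinuousLinearMap.star_eq_adjoint (tensorOp A B), ContinuousLinearMap.eq_adjoint_iff]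
  intro z w
  induction z, w using UniformSpace.Completion.induction_on₂ with
  | hp => exact isClosed_eq (by fun_prop) (by fun_prop)
  | ih a b =>
    induction a using TensorProduct.induction_on with
    | zero => rw [UniformSpace.Completion.coe_zero, map_zero, inner_zero_left, inner_zero_left]
    | add x y hx hy =>
      rw [UniformSpace.Completion.coe_add, map_add, inner_add_left, inner_add_left, hx, hy]
    | tmul x y =>
      induction b using TensorProduct.induction_on with
      | zero => rw [UniformSpace.Completion.coe_zero, map_zero, inner_zero_right, inner_zero_right]
      | add z w hx hy =>
        rw [UniformSpace.Completion.coe_add, map_add, inner_add_right, inner_add_right, hx, hy]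
      | tmul z w =>
        simp only [tensorOp_apply_tmul, UniformSpace.Completion.inner_coe,
          TensorProduct.inner_tmul, ContinuousLinearMap.star_eq_adjoint,
          ContinuousLinearMap.adjoint_inner_left]

/-- `A ↦ A ⊗ 1` as a star homomorphism. -/
def tensorOpLeft : (H →L[ℂ] H) →⋆ₐ[ℂ] (HilbertTensor H →L[ℂ] HilbertTensor H) where
  toFun A := tensorOp A 1
  map_one' := tensorOp_one_one
  map_mul' A B := by rw [tensorOp_mul_tensorOp, one_mul]
  map_zero' := by simpa using tensorOp_smul_left 0 (0 : H →L[ℂ] H) 1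
  map_add' A B := tensorOp_add_left A B 1
  commutes' c := by
    rw [Algebra.algebraMap_eq_smul_one, Algebra.algebraMap_eq_smul_one, tensorOp_smul_left,
      tensorOp_one_one]
  map_star' A := by rw [star_tensorOp, star_one]

/-- `B ↦ 1 ⊗ B` as a star homomorphism. -/
def tensorOpRight : (H →L[ℂ] H) →⋆ₐ[ℂ] (HilbertTensor H →L[ℂ] HilbertTensor H) where
  toFun B := tensorOp 1 B
  map_one' := tensorOp_one_one
  map_mul' A B := by rw [tensorOp_mul_tensorOp, one_mul]
  map_zero' := by simpa using tensorOp_smul_right 0 (1 : H →L[ℂ] H) 0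
  map_add' A B := tensorOp_add_right 1 A B
  commutes' c := by
    rw [Algebra.algebraMap_eq_smul_one, Algebra.algebraMap_eq_smul_one, tensorOp_smul_right,
      tensorOp_one_one]
  map_star' A := by rw [star_tensorOp, star_one]

theorem tensorOpLeft_mul_tensorOpRight (A B : H →L[ℂ] H) :
    tensorOpLeft A * tensorOpRight B = tensorOp A B := by
  change tensorOp A 1 * tensorOp 1 B = _
  rw [tensorOp_mul_tensorOp, mul_one, one_mul]

theorem commute_tensorOpLeft_tensorOpRight (A B : H →L[ℂ] H) :
    Commute (tensorOpLeft A) (tensorOpRight B) := by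
  change tensorOp A 1 * tensorOp 1 B = tensorOp 1 B * tensorOp A 1
  rw [tensorOp_mul_tensorOp, tensorOp_mul_tensorOp, mul_one, one_mul, mul_one, one_mul]

end TensorOp

section CommutingHoms

variable {A B : Type*} [CStarAlgebra A] [PartialOrder A] [StarOrderedRing A]
  [CStarAlgebra B] [PartialOrder B] [StarOrderedRing B] {φ ψ : A →⋆ₐ[ℂ] B}

theorem map_mul_map_nonneg (hc : ∀ x y, Commute (φ x) (ψ y)) {x y : A} (hx : 0 ≤ x)
    (hy : 0 ≤ y) : 0 ≤ φ x * ψ y := by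
  exact Commute.mul_nonneg (map_nonneg φ hx) (map_nonneg ψ hy) (hc x y)

theorem map_mul_map_mono (hc : ∀ x y, Commute (φ x) (ψ y)) {x x' y y' : A} (hx : x ≤ x')
    (hy : y ≤ y') (hx' : 0 ≤ x') (hy0 : 0 ≤ y) : φ x * ψ y ≤ φ x' * ψ y' := by
  calc φ x * ψ y ≤ φ x' * ψ y := by
        rw [← sub_nonneg, ← sub_mul, ← map_sub]
        exact map_mul_map_nonneg hc (sub_nonneg.2 hx) hy0
    _ ≤ φ x' * ψ y' := by
        rw [← sub_nonneg, ← mul_sub, ← map_sub]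
        exact map_mul_map_nonneg hc hx' (sub_nonneg.2 hy)

theorem map_smul_one_mul_map_smul_one (s t : ℝ) :
    φ (s • 1) * ψ (t • 1) = (s * t) • (1 : B) := by
  rw [← Complex.coe_smul, ← Complex.coe_smul, map_smul, map_smul, map_one, map_one,
    smul_mul_smul_comm, one_mul, ← Complex.ofReal_mul, Complex.coe_smul]

/-- A star homomorphism does not enlarge the spectrum, so a lower bound for `f s * f t` on the
product of the spectra gives a bound for `φ(f(S)) ψ(f(T))`. -/
theorem smul_map_mul_map_add_le (hc : ∀ x y, Commute (φ x) (ψ y)) {S T : A}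
    (hS : IsSelfAdjoint S) (hT : IsSelfAdjoint T) {f : ℝ → ℝ}
    (hfS : ContinuousOn f (spectrum ℝ S)) (hfT : ContinuousOn f (spectrum ℝ T)) {μ ν : ℝ}
    (h : ∀ s ∈ spectrum ℝ S, ∀ t ∈ spectrum ℝ T, μ * (s * t) + ν ≤ f s * f t) :
    μ • (φ S * ψ T) + ν • (1 : B) ≤ φ (cfc f S) * ψ (cfc f T) := by
  have hl : spectrum ℝ (φ S) ⊆ spectrum ℝ S :=
    AlgHom.spectrum_apply_subset (φ.restrictScalars ℝ) S
  have hr : spectrum ℝ (ψ T) ⊆ spectrum ℝ T :=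
    AlgHom.spectrum_apply_subset (ψ.restrictScalars ℝ) T
  have hl' : φ (cfc f S) = cfc f (φ S) :=
    StarAlgHomClass.map_cfc φ f S hfS (map_continuous _) hS (hS.map _)
  have hr' : ψ (cfc f T) = cfc f (ψ T) :=
    StarAlgHomClass.map_cfc ψ f T hfT (map_continuous _) hT (hT.map _)
  rw [hl', hr']
  exact (hc S T).smul_mul_add_le_cfc_mul_cfc (hS.map _) (hT.map _)
    (hfS.mono hl) (hfT.mono hr) fun s hs t ht => h s (hl hs) t (hr ht)

end CommutingHoms

section Compression

variable {H K : Type*} [NormedAddCommGroup H] [InnerProductSpace ℂ H] [CompleteSpace H]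
  [NormedAddCommGroup K] [InnerProductSpace ℂ K] [CompleteSpace K] (V : H →ₗᵢ[ℂ] K)

/-- Compression `V* T V` by an isometry. -/
def compression (T : K →L[ℂ] K) : H →L[ℂ] H :=
  ContinuousLinearMap.adjoint V.toContinuousLinearMap ∘L T ∘L V.toContinuousLinearMap

theorem compression_smul_add_smul (s t : ℝ) (X Y : K →L[ℂ] K) :
    compression V (s • X + t • Y) = s • compression V X + t • compression V Y := by
  rw [← Complex.coe_smul, ← Complex.coe_smul, ← Complex.coe_smul, ← Complex.coe_smul]
  ext x
  simp [compression]

theorem compression_smul_one (s : ℝ) : compression V (s • 1) = s • 1 := by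
  rw [← Complex.coe_smul, ← Complex.coe_smul]
  ext x
  refine ext_inner_right ℂ fun y => ?_
  change inner ℂ (ContinuousLinearMap.adjoint V.toContinuousLinearMap ((s : ℂ) • V x)) y =
    inner ℂ ((s : ℂ) • x) y
  rw [ContinuousLinearMap.adjoint_inner_left, inner_smul_left, inner_smul_left]
  congr 1
  exact V.inner_map_map x y

theorem compression_mono {X Y : K →L[ℂ] K} (h : X ≤ Y) : compression V X ≤ compression V Y := by
  rw [ContinuousLinearMap.le_def] at h ⊢
  have := h.adjoint_conj V.toContinuousLinearMap
  convert this using 1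
  ext x
  simp [compression]

end Compression

/-! ### Transferring scalar affine bounds to means and Hadamard products. -/

section Conjugate

variable {A : Type*} [CStarAlgebra A] [PartialOrder A] [StarOrderedRing A]

/-- Take `r = a^(1/2)` and `s = a^(-1/2) c a^(-1/2)`; conjugating `α a ≤ c ≤ β a` by `a^(-1/2)`
locates the spectrum of `s`. -/
theorem IsStrictlyPositive.exists_conjugate_eq {a c : A} (ha : IsStrictlyPositive a)
    {α β : ℝ} (hα : 0 < α) (h1 : α • a ≤ c) (h2 : c ≤ β • a) :
    ∃ r s : A, IsUnit r ∧ star r = r ∧ r * r = a ∧ r * s * r = c ∧ IsStrictlyPositive s ∧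
      spectrum ℝ s ⊆ Set.Icc α β := by
  have hc : IsStrictlyPositive c := (ha.smul hα).of_le h1
  have hRs : star (CFC.sqrt a) = CFC.sqrt a := (CFC.sqrt_nonneg a).isSelfAdjoint.star_eq
  have hRR := CFC.sqrt_mul_sqrt_self a ha.nonneg
  obtain ⟨w, hw⟩ := ha.isUnit_cfcSqrt
  rw [← hw] at hRs hRR
  have hwi : star (↑w⁻¹ : A) = ↑w⁻¹ := by
    rw [← Units.coe_star, star_inv]
    have : star w = w := Units.ext hRs
    rw [this]
  have hwa : (↑w⁻¹ : A) * a * ↑w⁻¹ = 1 := by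
    rw [← hRR, ← mul_assoc, w.inv_mul, one_mul, w.mul_inv]
  have hS : IsStrictlyPositive ((↑w⁻¹ : A) * c * ↑w⁻¹) := by
    have := (w⁻¹).isUnit.isStrictlyPositive_star_left_conjugate_iff.2 hc
    rwa [hwi] at this
  have hback : (w : A) * ((↑w⁻¹ : A) * c * ↑w⁻¹) * w = c := by
    rw [mul_assoc, mul_assoc _ (↑w⁻¹ : A), w.inv_mul, mul_one, ← mul_assoc, w.mul_inv, one_mul]
  refine ⟨w, (↑w⁻¹ : A) * c * ↑w⁻¹, w.isUnit, hRs, hRR, hback, hS, fun x hx => ?_⟩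
  have k1 := star_left_conjugate_le_conjugate h1 (↑w⁻¹ : A)
  have k2 := star_left_conjugate_le_conjugate h2 (↑w⁻¹ : A)
  rw [hwi, mul_smul_comm, smul_mul_assoc, hwa, ← Algebra.algebraMap_eq_smul_one] at k1 k2
  exact ⟨(algebraMap_le_iff_le_spectrum hS.isSelfAdjoint).1 k1 x hx,
    (le_algebraMap_iff_spectrum_le hS.isSelfAdjoint).1 k2 x hx⟩

end Conjugate

namespace OperatorMean.IsRepresentedBy

variable {H : Type u} [NormedAddCommGroup H] [InnerProductSpace ℂ H] [CompleteSpace H]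
  {σ : OperatorMean.{u}} {f : ℝ → ℝ}

/-- The formula `A σ C = A^(1/2) f(A^(-1/2) C A^(-1/2)) A^(1/2)`. -/
theorem exists_op_eq (hf : σ.IsRepresentedBy f) {A C : H →L[ℂ] H} (hA : IsStrictlyPositive A)
    {α β : ℝ} (hα : 0 < α) (h1 : α • A ≤ C) (h2 : C ≤ β • A) :
    ∃ R S : H →L[ℂ] H, star R = R ∧ R * R = A ∧ R * S * R = C ∧ IsStrictlyPositive S ∧
      spectrum ℝ S ⊆ Set.Icc α β ∧ σ.op A C = R * cfc f S * R := by
  obtain ⟨R, S, hRu, hR, hRR, hRS, hS, hsp⟩ := hA.exists_conjugate_eq hα h1 h2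
  refine ⟨R, S, hR, hRR, hRS, hS, hsp, ?_⟩
  have := σ.star_mul_op_mul isStrictlyPositive_one hS hRu
  rw [hR, mul_one, hRR, hRS] at this
  rw [← this, hf.op_one_eq_cfc hS]

theorem op_le_smul_add_smul (hf : σ.IsRepresentedBy f) {A C : H →L[ℂ] H}
    (hA : IsStrictlyPositive A) {α β p q : ℝ} (hα : 0 < α) (h1 : α • A ≤ C) (h2 : C ≤ β • A)
    (h : ∀ t ∈ Set.Icc α β, f t ≤ p * t + q) : σ.op A C ≤ p • C + q • A := by
  obtain ⟨R, S, hR, hRR, hRS, hS, hsp, hop⟩ := hf.exists_op_eq hA hα h1 h2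
  have key : cfc f S ≤ p • S + q • 1 := by
    have e : p • S + q • 1 = cfc (fun x => p * x + q) S := by
      rw [cfc_add_const _ _ _ (by fun_prop) hS.isSelfAdjoint, cfc_const_mul _ _ _ (by fun_prop),
        cfc_id' ℝ S hS.isSelfAdjoint, Algebra.algebraMap_eq_smul_one]
    rw [e]
    exact cfc_mono (fun x hx => h x (hsp hx)) (hf.continuousOn_spectrum hS) (by fun_prop)
  have := star_left_conjugate_le_conjugate key R
  rw [hR, ← hop] at this
  refine this.trans (le_of_eq ?_)
  rw [mul_add, add_mul, mul_smul_comm, mul_smul_comm, smul_mul_assoc, smul_mul_assoc, mul_one,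
    hRS, hRR]

end OperatorMean.IsRepresentedBy

section AbstractHadamard

variable {H : Type u} [NormedAddCommGroup H] [InnerProductSpace ℂ H] [CompleteSpace H]
  {K : Type*} [NormedAddCommGroup K] [InnerProductSpace ℂ K] [CompleteSpace K]
  {φ ψ : (H →L[ℂ] H) →⋆ₐ[ℂ] (K →L[ℂ] K)} {σ : OperatorMean.{u}} {f : ℝ → ℝ}

theorem OperatorMean.IsRepresentedBy.smul_map_mul_map_add_le_op (hf : σ.IsRepresentedBy f)
    (hc : ∀ x y, Commute (φ x) (ψ y)) {A B C D : H →L[ℂ] H}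
    (hA : IsStrictlyPositive A) (hB : IsStrictlyPositive B) {α β α' β' p q : ℝ}
    (hα : 0 < α) (h1 : α • A ≤ C) (h2 : C ≤ β • A) (hα' : 0 < α') (h1' : α' • B ≤ D)
    (h2' : D ≤ β' • B)
    (h : ∀ s ∈ Set.Icc α β, ∀ t ∈ Set.Icc α' β', p * (s * t) + q ≤ f s * f t) :
    p • (φ C * ψ D) + q • (φ A * ψ B) ≤ φ (σ.op A C) * ψ (σ.op B D) := by
  obtain ⟨R, S, hR, hRR, hRS, hS, hsp, hop⟩ := hf.exists_op_eq hA hα h1 h2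
  obtain ⟨Q, T, hQ, hQQ, hQT, hT, hsp', hop'⟩ := hf.exists_op_eq hB hα' h1' h2'
  have key := smul_map_mul_map_add_le hc hS.isSelfAdjoint hT.isSelfAdjoint
    (hf.continuousOn_spectrum hS) (hf.continuousOn_spectrum hT)
    (fun s hs t ht => h s (hsp hs) t (hsp' ht))
  -- Commutation of the two ranges lets conjugation by `φ R * ψ Q` act on each factor separately.
  have conj_eq (X Y : H →L[ℂ] H) : star (φ R * ψ Q) * (φ X * ψ Y) * (φ R * ψ Q) =
      φ (R * X * R) * ψ (Q * Y * Q) := by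
    rw [star_mul, ← map_star, ← map_star, hR, hQ, ← (hc R Q).eq]
    simp only [map_mul]
    calc φ R * ψ Q * (φ X * ψ Y) * (φ R * ψ Q)
        = φ R * (ψ Q * φ X) * (ψ Y * φ R) * ψ Q := by simp only [mul_assoc]
      _ = φ R * (φ X * ψ Q) * (φ R * ψ Y) * ψ Q := by rw [(hc X Q).eq, (hc R Y).eq]
      _ = φ R * φ X * (ψ Q * φ R) * ψ Y * ψ Q := by simp only [mul_assoc]
      _ = φ R * φ X * (φ R * ψ Q) * ψ Y * ψ Q := by rw [(hc R Q).eq]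
      _ = φ R * φ X * φ R * (ψ Q * ψ Y * ψ Q) := by simp only [mul_assoc]
  have h11 : (1 : K →L[ℂ] K) = φ 1 * ψ 1 := by rw [_root_.map_one φ, _root_.map_one ψ, one_mul]
  have := star_left_conjugate_le_conjugate key (φ R * ψ Q)
  rw [conj_eq, ← hop, ← hop'] at this
  refine le_trans (le_of_eq ?_) this
  rw [h11, mul_add, add_mul, mul_smul_comm, mul_smul_comm, smul_mul_assoc, smul_mul_assoc,
    conj_eq, conj_eq, mul_one, mul_one, hRS, hRR, hQT, hQQ]

end AbstractHadamard

section HadamardProd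

variable {H : Type u} [NormedAddCommGroup H] [InnerProductSpace ℂ H] [CompleteSpace H]
  {ι : Type v} (e : HilbertBasis ι ℂ H)

/-- The Hadamard product as the compression of a product of commuting representations. -/
theorem exists_hadamardProd_eq_compression :
    ∃ (K : Type u) (_ : NormedAddCommGroup K) (_ : InnerProductSpace ℂ K) (_ : CompleteSpace K)
      (V : H →ₗᵢ[ℂ] K) (φ ψ : (H →L[ℂ] H) →⋆ₐ[ℂ] (K →L[ℂ] K)),
      (∀ A B, Commute (φ A) (ψ B)) ∧
        ∀ A B, hadamardProd e A B = compression V (φ A * ψ B) :=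
  ⟨HilbertTensor H, inferInstance, inferInstance, inferInstance, diagIsometry e, tensorOpLeft,
    tensorOpRight, commute_tensorOpLeft_tensorOpRight, fun A B => by
      rw [tensorOpLeft_mul_tensorOpRight]; rfl⟩

theorem smul_one_le_hadamardProd {A B : H →L[ℂ] H} {s t : ℝ} (hs : 0 ≤ s) (ht : 0 ≤ t)
    (hA : s • (1 : H →L[ℂ] H) ≤ A) (hB : t • (1 : H →L[ℂ] H) ≤ B) :
    (s * t) • (1 : H →L[ℂ] H) ≤ hadamardProd e A B := by
  obtain ⟨K, _, _, _, V, φ, ψ, hc, hV⟩ := exists_hadamardProd_eq_compression e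
  have h := compression_mono V (map_mul_map_mono hc hA hB
    ((smul_nonneg hs zero_le_one).trans hA) (smul_nonneg ht zero_le_one))
  rwa [map_smul_one_mul_map_smul_one, compression_smul_one, ← hV] at h

theorem hadamardProd_le_smul_one {A B : H →L[ℂ] H} {s t : ℝ} (hs : 0 ≤ s)
    (hA : A ≤ s • (1 : H →L[ℂ] H)) (hB : B ≤ t • (1 : H →L[ℂ] H)) (hB0 : 0 ≤ B) :
    hadamardProd e A B ≤ (s * t) • (1 : H →L[ℂ] H) := by
  obtain ⟨K, _, _, _, V, φ, ψ, hc, hV⟩ := exists_hadamardProd_eq_compression e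
  have h := compression_mono V (map_mul_map_mono hc hA hB (smul_nonneg hs zero_le_one) hB0)
  rwa [map_smul_one_mul_map_smul_one, compression_smul_one, ← hV] at h

theorem OperatorMean.IsRepresentedBy.smul_hadamardProd_add_le {σ : OperatorMean.{u}} {f : ℝ → ℝ}
    (hf : σ.IsRepresentedBy f) {A B C D : H →L[ℂ] H}
    (hA : IsStrictlyPositive A) (hB : IsStrictlyPositive B) {α β α' β' p q : ℝ}
    (hα : 0 < α) (h1 : α • A ≤ C) (h2 : C ≤ β • A) (hα' : 0 < α') (h1' : α' • B ≤ D)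
    (h2' : D ≤ β' • B)
    (h : ∀ s ∈ Set.Icc α β, ∀ t ∈ Set.Icc α' β', p * (s * t) + q ≤ f s * f t) :
    p • hadamardProd e C D + q • hadamardProd e A B ≤
      hadamardProd e (σ.op A C) (σ.op B D) := by
  obtain ⟨K, _, _, _, V, φ, ψ, hc, hV⟩ := exists_hadamardProd_eq_compression e
  have h := compression_mono V (hf.smul_map_mul_map_add_le_op hc hA hB hα h1 h2 hα' h1' h2' h)
  rwa [compression_smul_add_smul, ← hV, ← hV, ← hV] at h

end HadamardProd

/-! ### Concavity of `f` and convexity of `x ↦ f (1/x)`. -/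

theorem realMatrixOp_zero : realMatrixOp.{u} 0 = 0 := by
  simpa using realMatrixOp_add.{u} 0 0

theorem smul_realMatrix (c x y z w : ℝ) :
    c • !![x, y; z, w] = !![c * x, c * y; c * z, c * w] := by
  ext i j
  fin_cases i <;> fin_cases j <;> simp

namespace OperatorMean.IsRepresentedBy

variable {σ : OperatorMean.{u}} {f : ℝ → ℝ}

/-- Trace and determinant force the spectrum into `{s, t}` (Cayley–Hamilton), where `f` agrees with
its linear interpolant. -/
theorem op_one_realMatrixOp (hf : σ.IsRepresentedBy f) {s t x y z : ℝ} (hs : 0 < s)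
    (hst : s < t) (hx : 0 < x) (htr : x + z = s + t) (hdet : x * z = y ^ 2 + s * t) :
    σ.op 1 (realMatrixOp.{u} !![x, y; y, z]) =
      realMatrixOp (((f t - f s) / (t - s)) • !![x, y; y, z] +
        (f s - (f t - f s) / (t - s) * s) • 1) := by
  have ht := hs.trans hst
  set T := realMatrixOp.{u} !![x, y; y, z] with hTdef
  have hT : IsStrictlyPositive T :=
    realMatrixOp_isStrictlyPositive hx (by have := mul_pos hs ht; linarith)
  have hspec : ∀ r ∈ spectrum ℝ T, r = s ∨ r = t := by
    have h0 : cfc (fun r : ℝ => (r - s) * (r - t)) T = cfc (fun _ : ℝ => (0 : ℝ)) T := by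
      have e1 : cfc (fun r : ℝ => (r - s) * (r - t)) T = (T - s • 1) * (T - t • 1) := by
        rw [cfc_mul _ _ _ (by fun_prop) (by fun_prop), cfc_sub _ _ _, cfc_sub _ _ _,
          cfc_const _ _ hT.isSelfAdjoint, cfc_const _ _ hT.isSelfAdjoint,
          cfc_id' ℝ T hT.isSelfAdjoint, Algebra.algebraMap_eq_smul_one,
          Algebra.algebraMap_eq_smul_one]
      have e2 (c : ℝ) : T - c • 1 = realMatrixOp !![x - c, y; y, z - c] := by
        rw [sub_eq_iff_eq_add, hTdef, ← realMatrixOp_one, ← realMatrixOp_smul, ← realMatrixOp_add]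
        congr 1
        ext i j
        fin_cases i <;> fin_cases j <;> simp
      rw [e1, e2, e2, ← realMatrixOp_mul, Matrix.mul_fin_two, cfc_const_zero, ← realMatrixOp_zero]
      congr 1
      ext i j
      fin_cases i <;> fin_cases j <;> simp
      · linear_combination -hdet + x * htr
      · linear_combination y * htr
      · linear_combination y * htr
      · linear_combination -hdet + z * htr
    intro r hr
    have := (cfc_eq_cfc_iff_eqOn (R := ℝ) (ha := hT.isSelfAdjoint)).1 h0 hr
    rcases mul_eq_zero.1 this with h | h
    · exact Or.inl (by linarith)
    · exact Or.inr (by linarith)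
  have hts : t - s ≠ 0 := (sub_pos.2 hst).ne'
  have hcongr : cfc f T =
      cfc (fun r => (f t - f s) / (t - s) * r + (f s - (f t - f s) / (t - s) * s)) T := by
    refine cfc_congr fun r hr => ?_
    rcases hspec r hr with rfl | rfl
    · simp
    · field_simp; ring
  rw [hf.op_one_eq_cfc hT, hcongr, cfc_add_const _ _ _ (by fun_prop) hT.isSelfAdjoint,
    cfc_const_mul _ _ _ (by fun_prop), cfc_id' ℝ T hT.isSelfAdjoint,
    Algebra.algebraMap_eq_smul_one, realMatrixOp_add, realMatrixOp_smul, realMatrixOp_smul,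
    realMatrixOp_one]

theorem entry_le_of_op_one_eq (hf : σ.IsRepresentedBy f) {x y z : ℝ} (hx : 0 < x)
    (hdet : y ^ 2 < x * z) {M : Matrix (Fin 2) (Fin 2) ℝ}
    (hM : σ.op 1 (realMatrixOp.{u} !![x, y; y, z]) = realMatrixOp M) : M 0 0 ≤ f x := by
  have hz : 0 < z := by
    by_contra! h
    nlinarith [mul_nonpos_of_nonneg_of_nonpos hx.le h, sq_nonneg y]
  have key (η : ℝ) (hη : 0 < η) : M 0 0 ≤ f x * (1 + η) := by
    -- The lower diagonal entry of `Y` is large enough that `T ≤ x Y` despite the off-diagonal `y`;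
    -- only the upper entry `1 + η` survives in the conclusion.
    have h := hf.op_one_le (realMatrixOp_isStrictlyPositive hx hdet) hx
      (Y := realMatrixOp !![1 + η, 0; 0, 1 + η + (z + y ^ 2 / (x * η)) / x]) ?_ ?_
    · rw [hM, ← realMatrixOp_smul] at h
      simpa using realMatrixOp_apply_zero_le h
    · rw [← realMatrixOp_one, Matrix.one_fin_two]
      refine realMatrixOp_le (by linarith) ?_
      have : 0 ≤ (z + y ^ 2 / (x * η)) / x := by positivity
      nlinarith
    · rw [← realMatrixOp_smul, smul_realMatrix]
      refine realMatrixOp_le (by nlinarith) ?_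
      have e : (x * (1 + η) - x) * (x * (1 + η + (z + y ^ 2 / (x * η)) / x) - z) =
          x * η * (x * (1 + η)) + y ^ 2 := by field_simp; ring
      rw [e, mul_zero, zero_sub, neg_sq]
      exact le_add_of_nonneg_left (by positivity)
  have hlim : Tendsto (fun η : ℝ => f x * (1 + η)) (𝓝[>] 0) (𝓝 (f x * (1 + 0))) :=
    (Continuous.tendsto (by fun_prop) 0).mono_left nhdsWithin_le_nhds
  rw [add_zero, mul_one] at hlim
  exact ge_of_tendsto hlim (by filter_upwards [self_mem_nhdsWithin] with η hη using key η hη)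

/-- Here `w = x - y² / z` is the Schur complement, the reciprocal of the `(0, 0)` entry of the
inverse matrix. Nearly `w` times the first coordinate projection fits below the matrix. -/
theorem le_entry_of_op_one_eq (hf : σ.IsRepresentedBy f) {x y z w : ℝ} (hx : 0 < x)
    (hz : 0 < z) (hw : 0 < w) (hdet : x * z = y ^ 2 + w * z) {M : Matrix (Fin 2) (Fin 2) ℝ}
    (hM : σ.op 1 (realMatrixOp.{u} !![x, y; y, z]) = realMatrixOp M) : f w ≤ M 0 0 := by
  have key (η : ℝ) (hη : η ∈ Set.Ioo (0 : ℝ) 1) : f w * (1 - η) ≤ M 0 0 := by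
    obtain ⟨h0, h1⟩ := hη
    have hden : 0 < y ^ 2 / z + w * η := by positivity
    -- `e` keeps the test matrix invertible; `e ≤ 1` gives `Y ≤ 1`, and the last bound makes the
    -- determinant of `T - w Y` nonnegative.
    obtain ⟨e, he0, he1, hde⟩ : ∃ e : ℝ, 0 < e ∧ e ≤ 1 ∧ e * (y ^ 2 / z + w * η) ≤ η * z :=
      ⟨min 1 (η * z / (y ^ 2 / z + w * η)), lt_min one_pos (by positivity), min_le_left _ _,
        (le_div_iff₀ hden).1 (min_le_right _ _)⟩
    have hmw : x - w = y ^ 2 / z := by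
      rw [eq_div_iff hz.ne']; linarith
    have hdet' : y ^ 2 < x * z := by
      have := mul_pos hw hz
      linarith
    have h := hf.le_op_one (realMatrixOp_isStrictlyPositive hx hdet') (Y := realMatrixOp !![1 - η, 0; 0, e])
      (realMatrixOp_isStrictlyPositive (by linarith)
        (by have := mul_pos (sub_pos.2 h1) he0; nlinarith)) hw ?_ ?_
    · rw [hM, ← realMatrixOp_smul] at h
      simpa using realMatrixOp_apply_zero_le h
    · rw [← realMatrixOp_one, Matrix.one_fin_two]
      refine realMatrixOp_le (by linarith) ?_
      nlinarith
    · rw [← realMatrixOp_smul, smul_realMatrix]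
      have e1 : x - w * (1 - η) = y ^ 2 / z + w * η := by rw [← hmw]; ring
      refine realMatrixOp_le (by rw [← sub_pos, e1]; exact hden) ?_
      have e2 : (y ^ 2 / z + w * η) * (z - w * e) =
          y ^ 2 + w * (η * z - e * (y ^ 2 / z + w * η)) := by
        field_simp; ring
      rw [e1, mul_zero, sub_zero, e2]
      exact le_add_of_nonneg_right (mul_nonneg hw.le (sub_nonneg.2 hde))
  have hlim : Tendsto (fun η : ℝ => f w * (1 - η)) (𝓝[>] 0) (𝓝 (f w * (1 - 0))) :=
    (Continuous.tendsto (by fun_prop) 0).mono_left nhdsWithin_le_nhds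
  rw [sub_zero, mul_one] at hlim
  exact le_of_tendsto hlim (by
    filter_upwards [Ioo_mem_nhdsGT one_pos] with η hη using key η hη)

/-- Jensen's inequality and its harmonic counterpart, read off from a `2 × 2` matrix with
eigenvalues `s`, `t` and `(0, 0)` entry `p s + q t`, whose inverse has `(0, 0)` entry
`p / s + q / t`. -/
theorem le_and_le_of_lt (hf : σ.IsRepresentedBy f) {s t p q : ℝ} (hs : 0 < s) (hst : s < t)
    (hp : 0 < p) (hq : 0 < q) (hpq : p + q = 1) :
    p * f s + q * f t ≤ f (p * s + q * t) ∧
      f ((p * s⁻¹ + q * t⁻¹)⁻¹) ≤ p * f s + q * f t := by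
  have ht := hs.trans hst
  have hts : t - s ≠ 0 := (sub_pos.2 hst).ne'
  have hm0 : 0 < p * s + q * t := by positivity
  have hr0 : 0 < q * s + p * t := by positivity
  -- Off-diagonal entry of `diag(s, t)` rotated by an orthogonal matrix with entries `±√p`, `±√q`.
  obtain ⟨d, hd⟩ : ∃ d : ℝ, d ^ 2 = p * q * (t - s) ^ 2 :=
    ⟨√(p * q) * (t - s), by rw [mul_pow, Real.sq_sqrt (by positivity)]⟩
  have hdet : (p * s + q * t) * (q * s + p * t) = d ^ 2 + s * t := by
    rw [hd]; linear_combination (s * t) * (p + q + 1) * hpq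
  have hop := hf.op_one_realMatrixOp hs hst hm0 (z := q * s + p * t)
    (by linear_combination (s + t) * hpq) hdet
  have hval : (f t - f s) / (t - s) * (p * s + q * t) +
      (f s - (f t - f s) / (t - s) * s) * 1 = p * f s + q * f t := by
    obtain rfl : p = 1 - q := by linarith
    field_simp
    ring
  have hdet' : d ^ 2 < (p * s + q * t) * (q * s + p * t) := by
    have := mul_pos hs ht
    linarith
  have h1 := hf.entry_le_of_op_one_eq hm0 hdet' hop
  have h2 := hf.le_entry_of_op_one_eq (w := (p * s⁻¹ + q * t⁻¹)⁻¹) hm0 hr0 (by positivity)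
    (by rw [hdet]; congr 1; field_simp; ring) hop
  simp only [Matrix.add_apply, Matrix.smul_apply, Matrix.of_apply, Matrix.cons_val_zero,
    Matrix.one_apply_eq, smul_eq_mul] at h1 h2
  rw [hval] at h1 h2
  exact ⟨h1, h2⟩

theorem le_and_le (hf : σ.IsRepresentedBy f) {s t p q : ℝ} (hs : 0 < s) (ht : 0 < t)
    (hp : 0 < p) (hq : 0 < q) (hpq : p + q = 1) :
    p * f s + q * f t ≤ f (p * s + q * t) ∧
      f ((p * s⁻¹ + q * t⁻¹)⁻¹) ≤ p * f s + q * f t := by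
  rcases lt_trichotomy s t with h | rfl | h
  · exact hf.le_and_le_of_lt hs h hp hq hpq
  · simp [← add_mul, hpq]
  · have := hf.le_and_le_of_lt ht h hq hp (by linarith)
    rwa [add_comm (q * f t), add_comm (q * t), add_comm (q * t⁻¹)] at this

theorem concaveOn (hf : σ.IsRepresentedBy f) : ConcaveOn ℝ (Set.Ioi 0) f :=
  concaveOn_iff_forall_pos.2 ⟨convex_Ioi 0, fun _ hx _ hy _ _ ha hb hab =>
    (hf.le_and_le hx hy ha hb hab).1⟩

theorem convexOn_comp_inv (hf : σ.IsRepresentedBy f) :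
    ConvexOn ℝ (Set.Ioi 0) fun x => f x⁻¹ :=
  convexOn_iff_forall_pos.2 ⟨convex_Ioi 0, fun x hx y hy a b ha hb hab => by
    simpa using (hf.le_and_le (inv_pos.2 hx) (inv_pos.2 hy) ha hb hab).2⟩

end OperatorMean.IsRepresentedBy

/-! ### One-variable analysis of `f` and its chord. -/

/-- A concave function `f` on `(0, ∞)` such that `x ↦ f(1 / x)` is convex has no kinks. -/
theorem ConcaveOn.differentiableAt_of_convexOn_comp_inv {f : ℝ → ℝ}
    (hf : ConcaveOn ℝ (Set.Ioi 0) f) (hg : ConvexOn ℝ (Set.Ioi 0) fun x => f x⁻¹) {c : ℝ}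
    (hc : 0 < c) : DifferentiableAt ℝ f c := by
  have hc' : c ∈ interior (Set.Ioi (0 : ℝ)) := by simpa using hc
  have hd' : c⁻¹ ∈ interior (Set.Ioi (0 : ℝ)) := by simpa using hc
  have hn := hf.neg
  have h1 := hn.leftDeriv_le_rightDeriv_of_mem_interior hc'
  have hr := (hn.hasDerivWithinAt_rightDeriv_of_mem_interior hc').neg
  have hl := (hn.hasDerivWithinAt_leftDeriv_of_mem_interior hc').neg
  have h2 := hg.leftDeriv_le_rightDeriv_of_mem_interior hd'
  have gr := hg.hasDerivWithinAt_rightDeriv_of_mem_interior hd'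
  have gl := hg.hasDerivWithinAt_leftDeriv_of_mem_interior hd'
  rw [neg_neg] at hr hl
  -- Inversion exchanges the two sides and has negative derivative, so convexity of `x ↦ f x⁻¹`
  -- orders the one-sided derivatives of `f` oppositely to concavity.
  have m1 : Set.MapsTo (fun x : ℝ => x⁻¹) (Set.Ioi c) (Set.Iio c⁻¹) := fun x hx =>
    inv_strictAnti₀ hc hx
  have m2 : Set.MapsTo (fun x : ℝ => x⁻¹) (Set.Ioo 0 c) (Set.Ioi c⁻¹) := fun x hx =>
    inv_strictAnti₀ hx.1 hx.2
  have fr := gl.comp c (hasDerivAt_inv hc.ne').hasDerivWithinAt m1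
  have fl := gr.comp c (hasDerivAt_inv hc.ne').hasDerivWithinAt m2
  have hcomp : ((fun x => f x⁻¹) ∘ fun x => x⁻¹) = f := by
    ext x; simp
  rw [hcomp] at fr fl
  have fl := fl.mono_of_mem_nhdsWithin (Ioo_mem_nhdsLT hc)
  have e1 := (uniqueDiffWithinAt_Ioi c).eq_deriv _ hr fr
  have e2 := (uniqueDiffWithinAt_Iio c).eq_deriv _ hl fl
  have h3 := mul_le_mul_of_nonneg_right h2 (inv_pos.2 (pow_pos hc 2)).le
  have e : derivWithin (-f) (Set.Iio c) c = derivWithin (-f) (Set.Ioi c) c := by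
    linarith
  rw [e] at hl
  have := hl.Iic_of_Iio.union hr.Ici_of_Ioi
  rw [Set.Iic_union_Ici, hasDerivWithinAt_univ] at this
  exact this.differentiableAt

/-- A continuous function on `[b, a]` that is nowhere below its common boundary value attains its
maximum at an interior point. -/
theorem exists_mem_Ioo_forall_le {h : ℝ → ℝ} {a b : ℝ} (hba : b < a)
    (hc : ContinuousOn h (Set.Icc b a)) (hab : h a = h b) (hle : ∀ t ∈ Set.Icc b a, h b ≤ h t) :
    ∃ c ∈ Set.Ioo b a, ∀ t ∈ Set.Icc b a, h t ≤ h c := by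
  obtain ⟨x, hx, hmax⟩ := isCompact_Icc.exists_isMaxOn (Set.nonempty_Icc.2 hba.le) hc
  have hmid : (b + a) / 2 ∈ Set.Ioo b a := ⟨by linarith, by linarith⟩
  -- If the maximum is the boundary value, `h` is constant and the midpoint serves.
  by_cases hxb : h x = h b
  · exact ⟨_, hmid, fun t ht => (hmax ht).trans
      (hxb.le.trans (hle _ (Set.Ioo_subset_Icc_self hmid)))⟩
  · refine ⟨x, ⟨lt_of_le_of_ne hx.1 ?_, lt_of_le_of_ne hx.2 ?_⟩, fun t ht => hmax ht⟩
    · rintro rfl; exact hxb rfl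
    · rintro rfl; exact hxb hab

theorem ConcaveOn.le_of_chord {f : ℝ → ℝ} {s : Set ℝ} (hf : ConcaveOn ℝ s f) {a b μ ν : ℝ}
    (hb : b ∈ s) (ha : a ∈ s) (hba : b < a) (h1 : μ * b + ν = f b) (h2 : μ * a + ν = f a) :
    ∀ t ∈ Set.Icc b a, μ * t + ν ≤ f t := by
  intro t ht
  have hab : 0 < a - b := sub_pos.2 hba
  have h := hf.2 hb ha (div_nonneg (sub_nonneg.2 ht.2) hab.le)
    (div_nonneg (sub_nonneg.2 ht.1) hab.le) (by field_simp; ring)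
  have e : (a - t) / (a - b) * b + (t - b) / (a - b) * a = t := by field_simp; ring
  simp only [smul_eq_mul] at h
  rw [e, ← h1, ← h2] at h
  refine le_trans (le_of_eq ?_) h
  field_simp
  ring

/-- A submultiplicative representing function that takes equal values at two points is constant. -/
theorem OperatorMean.IsRepresentedBy.eq_one_of_le {σ : OperatorMean.{u}} {f : ℝ → ℝ}
    (hf : σ.IsRepresentedBy f) (hsub : Submultiplicative f) {a b : ℝ} (hb : 0 < b) (hba : b < a)
    (h : f a ≤ f b) {x : ℝ} (hx : 0 < x) : f x = 1 := by
  have hconc := hf.concaveOn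
  have hmono := hf.monotoneOn
  have ha := hb.trans hba
  -- By concavity, a slope that is once nonpositive stays so.
  have flat {r s t : ℝ} (hr : 0 < r) (hrs : r < s) (hst : s < t) (hfrs : f s ≤ f r) :
      f t ≤ f s := by
    have := hconc.slope_anti_adjacent hr (hr.trans (hrs.trans hst)) hrs hst
    rw [div_le_div_iff₀ (sub_pos.2 hst) (sub_pos.2 hrs)] at this
    have h1 := mul_nonpos_of_nonpos_of_nonneg (sub_nonpos.2 hfrs) (sub_pos.2 hst).le
    by_contra! h2
    have := mul_pos (sub_pos.2 h2) (sub_pos.2 hrs)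
    linarith
  have hconst (t : ℝ) (ht : a ≤ t) : f t = f a := by
    rcases ht.eq_or_lt with rfl | ht'
    · rfl
    · exact le_antisymm (flat hb hba ht' h) (hmono ha (ha.trans ht') ht)
  -- With `T` so large that `T` and `t T` are both at least `a`, `f a = f (t T) ≤ f t * f T = f t *
  -- f a`.
  have hone_le (t : ℝ) (ht : 0 < t) : 1 ≤ f t := by
    have h1 := hsub t (max a (a / t)) ht (lt_max_of_lt_left ha)
    have h2 : a ≤ t * max a (a / t) :=
      calc a = t * (a / t) := by field_simp
        _ ≤ t * max a (a / t) := by gcongr; exact le_max_right _ _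
    rw [hconst _ h2, hconst _ (le_max_left _ _)] at h1
    exact (le_mul_iff_one_le_left (hf.pos ha)).1 h1
  refine le_antisymm ?_ (hone_le x hx)
  rcases le_or_gt x 1 with h1 | h1
  · exact (hmono hx (Set.mem_Ioi.2 one_pos) h1).trans hf.map_one.le
  · have := flat (r := 1 / 2) (s := 1) (by norm_num) (by norm_num) h1
      (hf.map_one.le.trans (hone_le _ (by norm_num)))
    rwa [hf.map_one] at this

/-- At an interior maximum of the quotient of `f` by its chord on `[b, a]`, the slope of `f` is
the maximal quotient times the slope of the chord. -/
theorem exists_deriv_eq_and_forall_le {f : ℝ → ℝ} {a b μ ν : ℝ} (hba : b < a)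
    (hcont : ContinuousOn f (Set.Icc b a)) (hdiff : ∀ t ∈ Set.Ioo b a, DifferentiableAt ℝ f t)
    (h1 : μ * b + ν = f b) (h2 : μ * a + ν = f a) (hpos : ∀ t ∈ Set.Icc b a, 0 < μ * t + ν)
    (hle : ∀ t ∈ Set.Icc b a, μ * t + ν ≤ f t) :
    ∃ c ∈ Set.Ioo b a, ∃ M : ℝ, 0 < M ∧ deriv f c = M * μ ∧
      ∀ t ∈ Set.Icc b a, f t ≤ M * (μ * t + ν) := by
  have hbI : b ∈ Set.Icc b a := Set.left_mem_Icc.2 hba.le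
  have haI : a ∈ Set.Icc b a := Set.right_mem_Icc.2 hba.le
  have hone : f b / (μ * b + ν) = 1 := by
    rw [h1, div_self]; rw [← h1]; exact (hpos b hbI).ne'
  have hone' : f a / (μ * a + ν) = 1 := by
    rw [h2, div_self]; rw [← h2]; exact (hpos a haI).ne'
  obtain ⟨c, hc, hmax⟩ := exists_mem_Ioo_forall_le (h := fun t => f t / (μ * t + ν)) hba
    (hcont.div (by fun_prop) fun t ht => (hpos t ht).ne') (hone'.trans hone.symm)
    (fun t ht => by rw [hone]; exact (one_le_div (hpos t ht)).2 (hle t ht))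
  have hcI := Set.Ioo_subset_Icc_self hc
  have hL := hpos c hcI
  have hd := ((hdiff c hc).hasDerivAt).div
    (((hasDerivAt_id c).const_mul μ).add_const ν) hL.ne'
  have hloc : IsLocalMax (fun t => f t / (μ * t + ν)) c := by
    filter_upwards [Ioo_mem_nhds hc.1 hc.2] with t ht using hmax t (Set.Ioo_subset_Icc_self ht)
  have hz := hloc.hasDerivAt_eq_zero hd
  refine ⟨c, hc, f c / (μ * c + ν), div_pos (hL.trans_le (hle c hcI)) hL, ?_, fun t ht => ?_⟩
  · rw [div_eq_zero_iff] at hz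
    rcases hz with hz | hz
    · simp only [id_eq, mul_one] at hz
      rw [div_mul_eq_mul_div, eq_div_iff hL.ne']
      linarith
    · exact absurd hz (pow_ne_zero 2 hL.ne')
  · exact (div_le_iff₀ (hpos t ht)).1 (hmax t ht)

/-! ### The two Hadamard product bounds and the theorem. -/

theorem smul_smul_one_le_of_bounds {H : Type u} [NormedAddCommGroup H] [InnerProductSpace ℂ H]
    [CompleteSpace H] {X Y : H →L[ℂ] H} {x y : ℝ} (hx : 0 < x) (hy : 0 ≤ y)
    (hX : X ≤ x • (1 : H →L[ℂ] H)) (hY : y • (1 : H →L[ℂ] H) ≤ Y) : (y / x) • X ≤ Y := by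
  refine (smul_le_smul_of_nonneg_left hX (div_nonneg hy hx.le)).trans (le_trans (le_of_eq ?_) hY)
  rw [smul_smul, div_mul_cancel₀ _ hx.ne']

theorem le_smul_of_bounds {H : Type u} [NormedAddCommGroup H] [InnerProductSpace ℂ H]
    [CompleteSpace H] {X Y : H →L[ℂ] H} {x y : ℝ} (hx : 0 < x) (hy : 0 ≤ y)
    (hX : x • (1 : H →L[ℂ] H) ≤ X) (hY : Y ≤ y • (1 : H →L[ℂ] H)) : Y ≤ (y / x) • X := by
  refine hY.trans (le_trans (le_of_eq ?_) (smul_le_smul_of_nonneg_left hX (div_nonneg hy hx.le)))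
  rw [smul_smul, div_mul_cancel₀ _ hx.ne']

theorem OperatorMean.IsRepresentedBy.hadamardProd_bounds {σ : OperatorMean.{u}} {f : ℝ → ℝ}
    (hf : σ.IsRepresentedBy f) (hsub : Submultiplicative f)
    {a₁ a₂ a₃ a₄ b₁ b₂ b₃ b₄ a b μ ν : ℝ}
    (hb₁ : 0 < b₁) (hb₂ : 0 < b₂) (hb₃ : 0 < b₃) (hb₄ : 0 < b₄)
    (hab₁ : b₁ < a₁) (hab₂ : b₂ < a₂) (hab₃ : b₃ < a₃) (hab₄ : b₄ < a₄)
    (ha : a = a₃ * a₄ / (b₁ * b₂)) (hb : b = b₃ * b₄ / (a₁ * a₂))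
    (hle : ∀ t ∈ Set.Icc b a, μ * t + ν ≤ f t)
    {H : Type u} [NormedAddCommGroup H] [InnerProductSpace ℂ H] [CompleteSpace H]
    {ι : Type v} (e : HilbertBasis ι ℂ H) {A B C D : H →L[ℂ] H}
    (hA : b₁ • (1 : H →L[ℂ] H) ≤ A) (hA' : A ≤ a₁ • (1 : H →L[ℂ] H))
    (hB : b₂ • (1 : H →L[ℂ] H) ≤ B) (hB' : B ≤ a₂ • (1 : H →L[ℂ] H))
    (hC : b₃ • (1 : H →L[ℂ] H) ≤ C) (hC' : C ≤ a₃ • (1 : H →L[ℂ] H))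
    (hD : b₄ • (1 : H →L[ℂ] H) ≤ D) (hD' : D ≤ a₄ • (1 : H →L[ℂ] H)) :
    μ • hadamardProd e C D + ν • hadamardProd e A B ≤ hadamardProd e (σ.op A C) (σ.op B D) ∧
      ∀ p q : ℝ, (∀ t ∈ Set.Icc b a, f t ≤ p * t + q) →
        σ.op (hadamardProd e A B) (hadamardProd e C D) ≤
          p • hadamardProd e C D + q • hadamardProd e A B := by
  have ha₁ := hb₁.trans hab₁
  have ha₂ := hb₂.trans hab₂
  have ha₃ := hb₃.trans hab₃
  have ha₄ := hb₄.trans hab₄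
  have one_pos' := isStrictlyPositive_one (A := H →L[ℂ] H)
  have hAp := (one_pos'.smul hb₁).of_le hA
  have hBp := (one_pos'.smul hb₂).of_le hB
  have hDp := (one_pos'.smul hb₄).of_le hD
  constructor
  · refine hf.smul_hadamardProd_add_le e hAp hBp (div_pos hb₃ ha₁)
      (smul_smul_one_le_of_bounds ha₁ hb₃.le hA' hC) (le_smul_of_bounds hb₁ ha₃.le hA hC')
      (div_pos hb₄ ha₂) (smul_smul_one_le_of_bounds ha₂ hb₄.le hB' hD)
      (le_smul_of_bounds hb₂ ha₄.le hB hD') fun s hs t ht => ?_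
    have hs0 : 0 < s := (div_pos hb₃ ha₁).trans_le hs.1
    have ht0 : 0 < t := (div_pos hb₄ ha₂).trans_le ht.1
    -- The products `s t` fill at most `[b, a]`, since `b = (b₃/a₁)(b₄/a₂)` and `a =
    -- (a₃/b₁)(a₄/b₂)`.
    refine (hle (s * t) ⟨?_, ?_⟩).trans (hsub s t hs0 ht0)
    · rw [hb, ← div_mul_div_comm]
      exact mul_le_mul hs.1 ht.1 (div_pos hb₄ ha₂).le hs0.le
    · rw [ha, ← div_mul_div_comm]
      exact mul_le_mul hs.2 ht.2 ht0.le (div_pos ha₃ hb₁).le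
  · intro p q hpq
    have l1 := smul_one_le_hadamardProd e hb₁.le hb₂.le hA hB
    have u1 := hadamardProd_le_smul_one e ha₁.le hA' hB' hBp.nonneg
    have l2 := smul_one_le_hadamardProd e hb₃.le hb₄.le hC hD
    have u2 := hadamardProd_le_smul_one e ha₃.le hC' hD' hDp.nonneg
    refine hf.op_le_smul_add_smul ((one_pos'.smul (mul_pos hb₁ hb₂)).of_le l1)
      (div_pos (mul_pos hb₃ hb₄) (mul_pos ha₁ ha₂))
      (smul_smul_one_le_of_bounds (mul_pos ha₁ ha₂) (mul_pos hb₃ hb₄).le u1 l2)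
      (le_smul_of_bounds (mul_pos hb₁ hb₂) (mul_pos ha₃ ha₄).le l1 u2) ?_
    rw [← ha, ← hb]
    exact hpq

end

theorem theorem4p2 (σ : OperatorMean.{u}) (f : ℝ → ℝ) (hf : σ.IsRepresentedBy f)
    (hsub : Submultiplicative f)
    (a₁ a₂ a₃ a₄ b₁ b₂ b₃ b₄ : ℝ)
    (hb₁ : 0 < b₁) (hb₂ : 0 < b₂) (hb₃ : 0 < b₃) (hb₄ : 0 < b₄)
    (hab₁ : b₁ < a₁) (hab₂ : b₂ < a₂) (hab₃ : b₃ < a₃) (hab₄ : b₄ < a₄)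
    (a b μ ν : ℝ)
    (ha : a = a₃ * a₄ * b₁⁻¹ * b₂⁻¹) (hb : b = a₁⁻¹ * a₂⁻¹ * b₃ * b₄)
    (hμ : μ = a₁ * a₂ * b₁ * b₂ * (f a - f b) / (a₁ * a₂ * a₃ * a₄ - b₁ * b₂ * b₃ * b₄))
    (hν : ν = (a₁ * a₂ * a₃ * a₄ * f b - b₁ * b₂ * b₃ * b₄ * f a) /
      (a₁ * a₂ * a₃ * a₄ - b₁ * b₂ * b₃ * b₄)) :
    ((∃ s t : ℝ, 0 < s ∧ 0 < t ∧ f s ≠ f t) →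
      ∃ c ∈ Set.Ioo b a, DifferentiableAt ℝ f c ∧ 0 < deriv f c ∧
        ∃ ω : ℝ, ω = a₁ * a₂ * b₁ * b₂ * (f a - f b) /
            ((a₁ * a₂ * a₃ * a₄ - b₁ * b₂ * b₃ * b₄) * deriv f c) ∧ 0 < ω ∧
        ∀ (H : Type u) [NormedAddCommGroup H] [InnerProductSpace ℂ H] [CompleteSpace H]
          (ι : Type v) (e : HilbertBasis ι ℂ H) (A B C D : H →L[ℂ] H),
          b₁ • (1 : H →L[ℂ] H) ≤ A → A ≤ a₁ • (1 : H →L[ℂ] H) →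
          b₂ • (1 : H →L[ℂ] H) ≤ B → B ≤ a₂ • (1 : H →L[ℂ] H) →
          b₃ • (1 : H →L[ℂ] H) ≤ C → C ≤ a₃ • (1 : H →L[ℂ] H) →
          b₄ • (1 : H →L[ℂ] H) ≤ D → D ≤ a₄ • (1 : H →L[ℂ] H) →
          σ.op (hadamardProd e A B) (hadamardProd e C D) ≤
            (1 / ω) • hadamardProd e (σ.op A C) (σ.op B D)) ∧
    (∃ t₀ ∈ Set.Ioo b a,
        ∀ (H : Type u) [NormedAddCommGroup H] [InnerProductSpace ℂ H] [CompleteSpace H]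
          (ι : Type v) (e : HilbertBasis ι ℂ H) (A B C D : H →L[ℂ] H),
          b₁ • (1 : H →L[ℂ] H) ≤ A → A ≤ a₁ • (1 : H →L[ℂ] H) →
          b₂ • (1 : H →L[ℂ] H) ≤ B → B ≤ a₂ • (1 : H →L[ℂ] H) →
          b₃ • (1 : H →L[ℂ] H) ≤ C → C ≤ a₃ • (1 : H →L[ℂ] H) →
          b₄ • (1 : H →L[ℂ] H) ≤ D → D ≤ a₄ • (1 : H →L[ℂ] H) →
          σ.op (hadamardProd e A B) (hadamardProd e C D) - hadamardProd e (σ.op A C) (σ.op B D) ≤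
            (-(μ * t₀ + ν - f t₀)) • hadamardProd e A B) := by
  have ha₁ := hb₁.trans hab₁
  have ha₂ := hb₂.trans hab₂
  have ha₃ := hb₃.trans hab₃
  have ha₄ := hb₄.trans hab₄
  have ha' : a = a₃ * a₄ / (b₁ * b₂) := by rw [ha]; field_simp
  have hb' : b = b₃ * b₄ / (a₁ * a₂) := by rw [hb]; field_simp
  have hb0 : 0 < b := by rw [hb']; positivity
  have ha0 : 0 < a := by rw [ha']; positivity
  have hD : 0 < a₁ * a₂ * a₃ * a₄ - b₁ * b₂ * b₃ * b₄ := by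
    rw [sub_pos]
    gcongr
  have hDab : a₁ * a₂ * a₃ * a₄ - b₁ * b₂ * b₃ * b₄ = a₁ * a₂ * b₁ * b₂ * (a - b) := by
    rw [ha', hb']; field_simp
  have hba : b < a := by
    rw [hDab] at hD
    exact sub_pos.1 (pos_of_mul_pos_right hD (by positivity))
  have hne : a - b ≠ 0 := (sub_pos.2 hba).ne'
  have hμ' : μ = (f a - f b) / (a - b) := by rw [hμ, hDab]; field_simp
  have hν' : ν = (a * f b - b * f a) / (a - b) := by
    rw [hν, hDab, ha', hb']; field_simp
  have e1 : μ * b + ν = f b := by rw [hμ', hν']; field_simp; ring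
  have e2 : μ * a + ν = f a := by rw [hμ', hν']; field_simp; ring
  have hle := hf.concaveOn.le_of_chord hb0 ha0 hba e1 e2
  have hIcc : Set.Icc b a ⊆ Set.Ioi 0 := fun t ht => hb0.trans_le ht.1
  have hcont := hf.continuousOn.mono hIcc
  have hdiff (t : ℝ) (ht : 0 < t) : DifferentiableAt ℝ f t :=
    hf.concaveOn.differentiableAt_of_convexOn_comp_inv hf.convexOn_comp_inv ht
  refine ⟨fun ⟨s, t, hs, ht, hst⟩ => ?_, ?_⟩
  · have hfab : f b < f a := by
      by_contra! h
      exact hst ((hf.eq_one_of_le hsub hb0 hba h hs).trans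
        (hf.eq_one_of_le hsub hb0 hba h ht).symm)
    have hμ0 : 0 < μ := by rw [hμ']; exact div_pos (sub_pos.2 hfab) (sub_pos.2 hba)
    have hpos (t : ℝ) (ht : t ∈ Set.Icc b a) : 0 < μ * t + ν := by
      have := mul_le_mul_of_nonneg_left ht.1 hμ0.le
      have := hf.pos hb0
      linarith
    obtain ⟨c, hc, M, hM, hcM, hmax⟩ := exists_deriv_eq_and_forall_le hba hcont
      (fun t ht => hdiff t (hIcc (Set.Ioo_subset_Icc_self ht))) e1 e2 hpos hle
    -- The left side is `μ / f'(c)`, and `f'(c) = M μ`.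
    have hω : a₁ * a₂ * b₁ * b₂ * (f a - f b) /
        ((a₁ * a₂ * a₃ * a₄ - b₁ * b₂ * b₃ * b₄) * deriv f c) = 1 / M := by
      rw [← div_div, ← hμ, hcM]; field_simp
    refine ⟨c, hc, hdiff c (hIcc (Set.Ioo_subset_Icc_self hc)), hcM ▸ mul_pos hM hμ0, _, rfl,
      hω ▸ one_div_pos.2 hM, ?_⟩
    intro H _ _ _ ι e A B C D hA hA' hB hB' hC hC' hD hD'
    obtain ⟨h1, h2⟩ := hf.hadamardProd_bounds hsub hb₁ hb₂ hb₃ hb₄ hab₁ hab₂ hab₃ hab₄ ha' hb' hle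
      e hA hA' hB hB' hC hC' hD hD'
    rw [hω, one_div_one_div]
    refine (h2 (M * μ) (M * ν) fun t ht => (hmax t ht).trans (by linarith)).trans ?_
    rw [← smul_smul, ← smul_smul, ← smul_add]
    exact smul_le_smul_of_nonneg_left h1 hM.le
  · obtain ⟨t₀, ht₀, hmax⟩ := exists_mem_Ioo_forall_le (h := fun t => f t - (μ * t + ν)) hba
      (hcont.sub (by fun_prop)) (by simp only [e1, e2, sub_self])
      (fun t ht => by simp only [e1, sub_self]; linarith [hle t ht])
    refine ⟨t₀, ht₀, ?_⟩
    intro H _ _ _ ι e A B C D hA hA' hB hB' hC hC' hD hD'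
    obtain ⟨h1, h2⟩ := hf.hadamardProd_bounds hsub hb₁ hb₂ hb₃ hb₄ hab₁ hab₂ hab₃ hab₄ ha' hb' hle
      e hA hA' hB hB' hC hC' hD hD'
    -- The majorant is the chord raised until it touches the graph of `f` at `t₀`.
    have h3 := h2 μ (ν + -(μ * t₀ + ν - f t₀)) fun t ht => by
      have := hmax t ht
      linarith
    rw [add_smul, ← add_assoc] at h3
    rw [sub_le_iff_le_add']
    exact h3.trans (add_le_add_left h1 _)
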